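/- **Theorem 1.** For an NFA $N$ over a finite alphabet $\Sigma$ let $\mathrm{ambig}_N(n)$ be the maximal number of accepting computations of $N$ on a word of length $n$. For $r\in\mathbb N$ let $\Sigma_r$ be the alphabet of all $r$-element subsets of $\{1,\dots,r^{32}\}$, let $L_r=\{xy : x,y\in\Sigma_r,\ x\cap y\neq\emptyset\}$, and put $t=\lfloor r^{1/3}\rfloor$ and $L=(L_r)^t$, a set of words of length $2t$. For $k\ge 1$ let $\exists_k(L)$ be the set of all words $w_1w_2\cdots w_m$ ($m\in\mathbb N$) with blocks $w_i\in\Sigma_r^{2t}$ such that $w_i\in L$ for at least $k$ positions $i$. (a) There is an absolute constant $c>0$ such that for all $r\in\mathbb N$ and $k\ge1$ every NFA $N$ that recognizes $\exists_k(L)$ and satisfies $\mathrm{ambig}_N(n)=o(n^k)$ as $n\to\infty$ has at least $2^{c\,(r/k^2)^{1/3}}$ states. (b) There is a polynomial $p$ such that for all $r\in\mathbb N$ and $k\ge1$ the language $\exists_k(L)$ is recognized by an NFA $N$ (with a single initial state) with at most $k\cdot p(r)$ states and $\mathrm{ambig}_N(n)=O(n^k)$, where the constant in $O(n^k)$ may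 depend on $r$ and $k$. (c) In particular there is a hierarchy for polynomial ambiguity: there is a constant $\delta>0$ such that for every $k\ge1$ there are NFAs $N$ with arbitrarily large number $s$ of states (and a single initial state) and $\mathrm{ambig}_N(n)=O(n^k)$ such that every NFA $N'$ that recognizes the same language and satisfies $\mathrm{ambig}_{N'}(n)=o(n^k)$ has at least $2^{s^{\delta}}$ states. -/

import Mathlib

open Filter Asymptotics

namespace PolyAmbiguity

/-- The accepting computations of the NFA `M` on the word `w`: sequences of `|w| + 1` states that
begin in a start state, follow the transitions of `M` letter by letter along `w`, and end in an
accepting state. -/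
def acceptingComputations {α σ : Type} (M : NFA α σ) (w : List α) :
    Set (Fin (w.length + 1) → σ) :=
  {q | q 0 ∈ M.start ∧ (∀ i : Fin w.length, q i.succ ∈ M.step (q i.castSucc) (w.get i)) ∧
    q (Fin.last w.length) ∈ M.accept}

/-- The ambiguity of `M` on the word `w`: the number of accepting computations of `M` on `w`
(a finite set, since the automata considered have finitely many states). -/
noncomputable def wordAmbiguity {α σ : Type} (M : NFA α σ) (w : List α) : ℕ :=
  (acceptingComputations M w).ncard

/-- The ambiguity of `M` as a function of the input length `n`: the maximum of the ambiguity of `M`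
over all words of length `n`. -/
noncomputable def ambiguity {α σ : Type} [Fintype α] (M : NFA α σ) (n : ℕ) : ℕ :=
  Finset.univ.sup fun w : List.Vector α n => wordAmbiguity M w.toList

/-- The alphabet of all subsets of size `r` of a set with `r ^ 32` elements. -/
abbrev Letter (r : ℕ) : Type := {x : Finset (Fin (r ^ 32)) // x.card = r}

/-- The language of non-disjointness: all words `xy` of two letters with `x ∩ y ≠ ∅`. -/
def nonDisjointness (r : ℕ) : Language (Letter r) :=
  {w | ∃ x y : Letter r, w = [x, y] ∧ (x.1 ∩ y.1).Nonempty}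

/-- The number of iterations, `r ^ (1/3)` rounded down. -/
noncomputable def iterations (r : ℕ) : ℕ := ⌊(r : ℝ) ^ (1 / 3 : ℝ)⌋₊

/-- The iterated language of non-disjointness. All its words have length `2 * iterations r`. -/
noncomputable def iteratedNonDisjointness (r : ℕ) : Language (Letter r) :=
  nonDisjointness r ^ iterations r

open Classical in
/-- For a language `L` all of whose words have length `ℓ`: the words `w₁ w₂ ⋯ wₘ`, partitioned into
`m` blocks of length `ℓ` (with `m` arbitrary), such that `wᵢ ∈ L` for at least `k` positions `i`. -/
def atLeast {α : Type} (ℓ k : ℕ) (L : Language α) : Language α :=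
  {w | ∃ ws : List (List α), (∀ u ∈ ws, u.length = ℓ) ∧ w = ws.flatten ∧
    k ≤ ws.countP (fun u => decide (u ∈ L))}

/-- The language of words in which at least `k` blocks belong to the iterated language of
non-disjointness. -/
noncomputable def hierarchyLanguage (r k : ℕ) : Language (Letter r) :=
  atLeast (2 * iterations r) k (iteratedNonDisjointness r)

end PolyAmbiguity

/-! Lower bound. Suppose `M` recognizes the language with ambiguity `o(n ^ k)`. After trimming, no
word has two different paths from a state to itself, since pumping them would give exponential
ambiguity. Call a word negative if none of its blocks lies in `L`, and among the negative words
acting as idempotent relations let `e` have the fewest fixed states. Minimality forces `e * w * e`,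
for every negative `w`, to permute the fixed states within their classes of mutual reachability,
with exactly one path from each fixed state to the fixed states of its class
(`IsMinIdempotent.returns_eq_one`).

Suppose that some block `u ∈ L` has in total at least as many returning paths as there are fixed
states. Averaged over the permutations coming from negative words, inserting `u` then preserves the
number of paths inside each class (`IsMinIdempotent.totalReturns_eq`). On the other hand `e * (u *
e) ^ k` is accepted, and its computation visits `k + 1` fixed states. They are pairwise
inequivalent, because a negative shortcut would accept a word with fewer than `k` positive blocks.
In each of `n` rounds a path may therefore stay in its class or advance to the next one. This yields
a constant times `n.choose k` paths on a word of length `O(n)`, a contradiction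
(`IsMinIdempotent.exists_choose_le_paths`, `false_of_card_le_returns`).

Such a `u` exists if `M` is small. Restrict the letters to graphs of functions. Fixing the states
before, between and after two letters cuts out a combinatorial rectangle of pairs. By
`rectangle_corruption`, no rectangle has a noticeably negative weight if intersecting pairs weigh
`1` and disjoint ones `-1/8`. Hence the weighted number of paths over all sequences of `t` pairs,
which is read off from a matrix power, is almost nonnegative. The number of paths is one on each
sequence with a disjoint pair. So on sequences of intersecting pairs it averages at least one, up to
an error exponentially small in `t` (`sum_pairPaths_ge`). Once the error is below the reciprocal of
the number of states, integrality provides `u` (`exists_sequence_card_le`).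

Upper bound. An automaton guesses `k` blocks and, in each of them, a common element for every pair
of letters. On words of length `n` this leaves at most `(r ^ t * (n + 1)) ^ k` computations. The
hierarchy combines both bounds for large `r`. -/

namespace PolyAmbiguity

/-! ### Idempotent words with few fixed states -/

section Pumping

variable {W Q : Type*} [Monoid W] [Fintype Q] [DecidableEq Q] (φ : W →* Matrix Q Q ℕ)

/-- The word `w` can lead from state `p` to state `q`. -/
def Leads (w : W) (p q : Q) : Prop := 0 < φ w p q

instance (w : W) (p q : Q) : Decidable (Leads φ w p q) := inferInstanceAs (Decidable (0 < _))

lemma mul_apply_le (v w : W) (p m q : Q) : φ v p m * φ w m q ≤ φ (v * w) p q := by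
  rw [map_mul, Matrix.mul_apply]
  exact Finset.single_le_sum (f := fun m => φ v p m * φ w m q) (fun _ _ => Nat.zero_le _)
    (Finset.mem_univ m)

lemma sum_mul_apply_le (v w : W) (p q : Q) (s : Finset Q) :
    ∑ m ∈ s, φ v p m * φ w m q ≤ φ (v * w) p q := by
  rw [map_mul, Matrix.mul_apply]
  exact Finset.sum_le_sum_of_subset (Finset.subset_univ s)

variable {φ}

lemma leads_mul {v w : W} {p q : Q} : Leads φ (v * w) p q ↔ ∃ m, Leads φ v p m ∧ Leads φ w m q := by
  unfold Leads
  rw [map_mul, Matrix.mul_apply, Finset.sum_pos_iff]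
  simp [Nat.pos_iff_ne_zero]

lemma Leads.mul {v w : W} {p m q : Q} (h : Leads φ v p m) (h' : Leads φ w m q) :
    Leads φ (v * w) p q := leads_mul.2 ⟨m, h, h'⟩

lemma leads_one (p : Q) : Leads φ 1 p p := by simp [Leads]

/-- No word has two different paths from a state to itself. -/
def LoopUnambiguous (φ : W →* Matrix Q Q ℕ) : Prop := ∀ w p, φ w p p ≤ 1

/-- Distinct midpoints would give two closed paths at `p` on `v * w`. Most uniqueness statements
below come from this. -/
lemma LoopUnambiguous.eq_of_leads (h : LoopUnambiguous φ) {v w : W} {p m m' : Q}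
    (h₁ : Leads φ v p m) (h₂ : Leads φ w m p) (h₃ : Leads φ v p m') (h₄ : Leads φ w m' p) :
    m = m' := by
  by_contra hne
  have := sum_mul_apply_le φ v w p p {m, m'}
  rw [Finset.sum_pair hne] at this
  have h5 := h (v * w) p
  have h6 : 0 < φ v p m * φ w m p := Nat.mul_pos h₁ h₂
  have h7 : 0 < φ v p m' * φ w m' p := Nat.mul_pos h₃ h₄
  omega

lemma LoopUnambiguous.apply_le_one (h : LoopUnambiguous φ) {v w : W} {p q : Q}
    (h₂ : Leads φ w q p) : φ v p q ≤ 1 := by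
  have := (mul_apply_le φ v w p q p).trans (h (v * w) p)
  unfold Leads at h₂
  nlinarith

/-- The word `e` acts as an idempotent relation on the states. -/
def RelIdempotent (φ : W →* Matrix Q Q ℕ) (e : W) : Prop :=
  ∀ p q, Leads φ (e * e) p q ↔ Leads φ e p q

lemma leads_mul_congr_left {v v' : W} (h : ∀ p q, Leads φ v p q ↔ Leads φ v' p q) (w : W) (p q : Q) :
    Leads φ (v * w) p q ↔ Leads φ (v' * w) p q := by
  simp only [leads_mul, h]

lemma exists_pow_relIdempotent (φ : W →* Matrix Q Q ℕ) (w : W) :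
    ∃ n, 2 ≤ n ∧ RelIdempotent φ (w ^ n) := by
  obtain ⟨i, j, hij, h⟩ := Finite.exists_ne_map_eq_of_infinite
    (fun n : ℕ => {x : Q × Q | Leads φ (w ^ n) x.1 x.2})
  wlog hlt : i < j generalizing i j
  · exact this j i hij.symm h.symm (by omega)
  have h0 : ∀ p q, Leads φ (w ^ j) p q ↔ Leads φ (w ^ i) p q := fun p q =>
    (Set.ext_iff.1 h (p, q)).symm
  obtain ⟨d, rfl⟩ : ∃ d, j = i + d := ⟨j - i, by omega⟩
  have hd : 1 ≤ d := by omega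
  have h1 : ∀ m p q, Leads φ (w ^ (i + m + d)) p q ↔ Leads φ (w ^ (i + m)) p q := by
    intro m p q
    rw [show i + m + d = (i + d) + m by ring, pow_add w (i + d), pow_add w i m]
    exact leads_mul_congr_left h0 _ p q
  have h2 : ∀ l m p q, Leads φ (w ^ (i + m + l * d)) p q ↔ Leads φ (w ^ (i + m)) p q := by
    intro l
    induction l with
    | zero => intro m p q; simp
    | succ l ih =>
      intro m p q
      rw [show i + m + (l + 1) * d = i + (m + l * d) + d by ring, h1, ← ih m p q]
      rw [show i + (m + l * d) = i + m + l * d by ring]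
  -- The exponent `(i + 2) * d` is a multiple of the period `d` beyond the preperiod `i`, and it is
  -- at least `2`.
  have hle : i + 2 ≤ (i + 2) * d := Nat.le_mul_of_pos_right _ hd
  refine ⟨(i + 2) * d, by omega, fun p q => ?_⟩
  have := h2 (i + 2) ((i + 2) * d - i) p q
  rw [show i + ((i + 2) * d - i) = (i + 2) * d by omega] at this
  rw [← pow_add, this]

/-- Otherwise `e` would be a strict order on the states between `a` and `b`. Idempotence makes it
dense, which is impossible on a finite nonempty set. -/
lemma RelIdempotent.exists_fixed {e : W} (he : RelIdempotent φ e) {a b : Q} (h : Leads φ e a b) :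
    ∃ m, Leads φ e m m ∧ Leads φ e a m ∧ Leads φ e m b := by
  by_contra hcon
  push Not at hcon
  have tr : ∀ {x y z}, Leads φ e x y → Leads φ e y z → Leads φ e x z := fun h h' =>
    (he _ _).1 (h.mul h')
  let S := {c : Q // Leads φ e a c ∧ Leads φ e c b}
  let rel : S → S → Prop := fun x y => Leads φ e y.1 x.1
  have hwf : WellFounded rel := by
    have : IsTrans S rel := ⟨fun x y z h h' => tr h' h⟩
    have : Std.Irrefl rel := ⟨fun x hx => hcon x.1 hx x.2.1 x.2.2⟩
    exact Finite.wellFounded_of_trans_of_irrefl rel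
  have hne : Nonempty S := by
    obtain ⟨c, h1, h2⟩ := leads_mul.1 ((he a b).2 h)
    exact ⟨⟨c, h1, h2⟩⟩
  obtain ⟨x, -, hx⟩ := hwf.has_min Set.univ Set.univ_nonempty
  obtain ⟨c, h1, h2⟩ := leads_mul.1 ((he x.1 b).2 x.2.2)
  exact hx ⟨c, tr x.2.1 h1, h2⟩ trivial h1

variable (φ) in
/-- Mutual reachability through words of `D`. -/
def Sim (D : Submonoid W) (p q : Q) : Prop :=
  (∃ w ∈ D, Leads φ w p q) ∧ ∃ w ∈ D, Leads φ w q p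

noncomputable instance (D : Submonoid W) (p q : Q) : Decidable (Sim φ D p q) :=
  Classical.propDecidable _

lemma Sim.refl (D : Submonoid W) (p : Q) : Sim φ D p p :=
  ⟨⟨1, D.one_mem, leads_one p⟩, 1, D.one_mem, leads_one p⟩

lemma Sim.symm {D : Submonoid W} {p q : Q} (h : Sim φ D p q) : Sim φ D q p := ⟨h.2, h.1⟩

lemma Sim.trans {D : Submonoid W} {p q r : Q} (h : Sim φ D p q) (h' : Sim φ D q r) :
    Sim φ D p r := by
  obtain ⟨⟨a, ha, ha'⟩, b, hb, hb'⟩ := h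
  obtain ⟨⟨c, hc, hc'⟩, d, hd, hd'⟩ := h'
  exact ⟨⟨a * c, D.mul_mem ha hc, ha'.mul hc'⟩, d * b, D.mul_mem hd hb, hd'.mul hb'⟩

variable (φ) in
/-- An idempotent of `D` with the least number of fixed states. -/
structure IsMinIdempotent (D : Submonoid W) (e : W) : Prop where
  mem : e ∈ D
  idem : RelIdempotent φ e
  min : ∀ f ∈ D, RelIdempotent φ f → {p | Leads φ e p p}.ncard ≤ {p | Leads φ f p p}.ncard

variable (φ) in
lemma exists_isMinIdempotent (D : Submonoid W) : ∃ e, IsMinIdempotent φ D e := by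
  let S : Set W := {e | e ∈ D ∧ RelIdempotent φ e}
  have hS : S.Nonempty := ⟨1, D.one_mem, fun p q => by simp⟩
  obtain ⟨e, he, hmin⟩ := exists_minimalFor_of_wellFoundedLT (· ∈ S)
    (fun e => {p | Leads φ e p p}.ncard) hS
  refine ⟨e, he.1, he.2, fun f hf hf' => ?_⟩
  by_contra hlt
  exact hlt (hmin ⟨hf, hf'⟩ (le_of_not_ge hlt))

namespace IsMinIdempotent

variable {D : Submonoid W} {e : W} (he : IsMinIdempotent φ D e) (hφ : LoopUnambiguous φ)
include he

lemma sandwich_mem {w : W} (hw : w ∈ D) : e * w * e ∈ D :=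
  D.mul_mem (D.mul_mem he.mem hw) he.mem

omit he in
lemma sandwich_pow (w : W) (n : ℕ) : (e * w * e) ^ (n + 1) = e * ((w * e * e) ^ n * w) * e := by
  have : SemiconjBy e (w * e * e) (e * w * e) := by simp [SemiconjBy, mul_assoc]
  have h := (this.pow_right n).eq
  rw [pow_succ, ← mul_assoc, ← mul_assoc, ← h]
  simp [mul_assoc]

lemma sandwich_pow_mem {w : W} (hw : w ∈ D) (n : ℕ) : (w * e * e) ^ n * w ∈ D :=
  D.mul_mem (D.pow_mem (D.mul_mem (D.mul_mem hw he.mem) he.mem) n) hw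

omit he in
lemma leads_left (he : RelIdempotent φ e) (v : W) (p q : Q) :
    Leads φ (e * (e * v)) p q ↔ Leads φ (e * v) p q := by
  rw [← mul_assoc]; exact leads_mul_congr_left he v p q

omit he in
lemma leads_right (he : RelIdempotent φ e) (v : W) (p q : Q) :
    Leads φ (v * e * e) p q ↔ Leads φ (v * e) p q := by
  rw [mul_assoc, leads_mul, leads_mul]
  simp only [he _ _]

include hφ in
-- An idempotent power `f` of `e * w * e` absorbs `e` on both sides. Thus a loop of `f` at `m`
-- passes through a fixed state `g` of `e`, and `f` leads from `m` to `g` and back. Loop unambiguity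
-- gives `m = g`, so `f` fixes only states fixed by `e`, and minimality gives equality.
lemma exists_pow_fixed {w : W} (hw : w ∈ D) :
    ∃ n, ∀ p, Leads φ ((e * w * e) ^ (n + 2)) p p ↔ Leads φ e p p := by
  obtain ⟨n, hn, hf⟩ := exists_pow_relIdempotent φ (e * w * e)
  obtain ⟨n, rfl⟩ : ∃ m, n = m + 2 := ⟨n - 2, by omega⟩
  refine ⟨n, ?_⟩
  set f := (e * w * e) ^ (n + 2) with hfdef
  have hfD : f ∈ D := D.pow_mem (he.sandwich_mem hw) _
  obtain ⟨v, hv⟩ : ∃ v, f = e * v * e := ⟨_, sandwich_pow w (n + 1)⟩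
  have hl : ∀ p q, Leads φ (e * f) p q ↔ Leads φ f p q := by
    intro p q; rw [hv, mul_assoc]; exact leads_left he.idem _ p q
  have hr : ∀ p q, Leads φ (f * e) p q ↔ Leads φ f p q := by
    intro p q; rw [hv]; exact leads_right he.idem _ p q
  have hsub : {p | Leads φ f p p} ⊆ {p | Leads φ e p p} := by
    intro m (hm : Leads φ f m m)
    obtain ⟨x, h1, h2⟩ := leads_mul.1 ((hl m m).2 hm)
    obtain ⟨g, hg, h3, h4⟩ := he.idem.exists_fixed h1
    have h5 : Leads φ f g m := (hl g m).1 (h4.mul h2)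
    have h6 : Leads φ f m g := (hr m g).1 (hm.mul h3)
    have : m = g := hφ.eq_of_leads hm hm h6 h5
    exact this ▸ hg
  have heq := Set.eq_of_subset_of_ncard_le hsub (he.min f hfD hf) (Set.toFinite _)
  exact fun p => Set.ext_iff.1 heq p

include hφ in
-- A loop at `p` on a power of `e * w * e` passes through a fixed state of `e` at the end of its
-- first factor. The rest of the loop leads back to `p`.
lemma exists_target {w : W} (hw : w ∈ D) {p : Q} (hp : Leads φ e p p) :
    ∃ q, Leads φ e q q ∧ Sim φ D p q ∧ Leads φ (e * w * e) p q := by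
  obtain ⟨n, hn⟩ := he.exists_pow_fixed hφ hw
  have h := (hn p).2 hp
  rw [pow_succ'] at h
  obtain ⟨x, h1, h2⟩ := leads_mul.1 h
  obtain ⟨y, h3, h4⟩ := leads_mul.1 h1
  obtain ⟨g, hg, h5, h6⟩ := he.idem.exists_fixed h4
  have h7 : Leads φ (e * w * e) p g := h3.mul h5
  exact ⟨g, hg, ⟨⟨_, he.sandwich_mem hw, h7⟩, _, D.mul_mem he.mem
    (D.pow_mem (he.sandwich_mem hw) (n + 1)), h6.mul h2⟩, h7⟩

omit he in
include hφ in
lemma eq_of_loops {f : W} {p q : Q}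
    (hp : Leads φ f p p) (hq : Leads φ f q q) (h : Leads φ f p q) (hs : Sim φ D p q) : p = q := by
  obtain ⟨-, w, -, hw⟩ := hs
  exact hφ.eq_of_leads hp (h.mul hw) h (hq.mul hw)

include hφ in
-- Continue from `q` to a target `g` on `n + 1` further factors. Then `p` and `g` are equivalent
-- loops of `(e * w * e) ^ (n + 2)`, and the former leads to the latter, so they coincide. The
-- exponent serves all `p` and `q` at once, which is what the uniqueness of targets and sources
-- needs.
lemma exists_return {w : W} (hw : w ∈ D) :
    ∃ n, ∀ p q, Leads φ e p p → Leads φ e q q → Sim φ D p q → Leads φ (e * w * e) p q →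
      Leads φ ((e * w * e) ^ n) q p := by
  obtain ⟨n, hn⟩ := he.exists_pow_fixed hφ hw
  refine ⟨n + 1, fun p q hp hq hs h => ?_⟩
  have h1 := sandwich_pow (e := e) w n
  obtain ⟨g, hg, hs', h2⟩ := he.exists_target hφ (he.sandwich_pow_mem hw n) hq
  rw [← h1] at h2
  have h3 : Leads φ ((e * w * e) ^ (n + 2)) p g := by
    rw [pow_succ']; exact h.mul h2
  have : p = g := eq_of_loops hφ ((hn p).2 hp) ((hn g).2 hg) h3 (hs.trans hs')
  exact this ▸ h2

include hφ in
lemma target_unique {w : W} (hw : w ∈ D) {p q q' : Q} (hp : Leads φ e p p)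
    (hq : Leads φ e q q) (hs : Sim φ D p q) (h : Leads φ (e * w * e) p q)
    (hq' : Leads φ e q' q') (hs' : Sim φ D p q') (h' : Leads φ (e * w * e) p q') : q = q' := by
  obtain ⟨n, hn⟩ := he.exists_return hφ hw
  exact hφ.eq_of_leads h (hn p q hp hq hs h) h' (hn p q' hp hq' hs' h')

include hφ in
lemma source_unique {w : W} (hw : w ∈ D) {p p' q : Q} (hq : Leads φ e q q)
    (hp : Leads φ e p p) (hs : Sim φ D p q) (h : Leads φ (e * w * e) p q)
    (hp' : Leads φ e p' p') (hs' : Sim φ D p' q) (h' : Leads φ (e * w * e) p' q) : p = p' := by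
  obtain ⟨n, hn⟩ := he.exists_return hφ hw
  exact hφ.eq_of_leads (hn p q hp hq hs h) h (hn p' q hp' hq hs' h') h'

/-- The number of paths on `e * u * e` from `p` to a fixed state of `e` equivalent to `p`. -/
noncomputable def returns (_ : IsMinIdempotent φ D e) (u : W) (p : Q) : ℕ :=
  ∑ q with Leads φ e q q ∧ Sim φ D p q, φ (e * u * e) p q

include hφ in
-- There is exactly one target, and only one path to it, because the target leads back to `p`.
lemma returns_eq_one {w : W} (hw : w ∈ D) {p : Q} (hp : Leads φ e p p) : he.returns w p = 1 := by
  classical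
  obtain ⟨q, hq, hs, h⟩ := he.exists_target hφ hw hp
  unfold returns
  rw [Finset.sum_eq_single q]
  · obtain ⟨v, -, hv⟩ := hs.2
    exact le_antisymm (hφ.apply_le_one hv) h
  · intro b hb hne
    by_contra hb0
    rw [Finset.mem_filter] at hb
    exact hne (he.target_unique hφ hw hp hb.2.1 hb.2.2 (Nat.pos_of_ne_zero hb0) hq hs h)
  · intro h'; simp [hq, hs] at h'

end IsMinIdempotent

end Pumping

/-! ### Permutations of the fixed states and polynomial growth of the number of paths -/

namespace IsMinIdempotent

section Growth

variable {W Q : Type*} [Monoid W] [Fintype Q] [DecidableEq Q] {φ : W →* Matrix Q Q ℕ}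
  {D : Submonoid W} {e : W} (he : IsMinIdempotent φ D e) (hφ : LoopUnambiguous φ)
include he

open Classical in
/-- The permutations of the fixed states of `e` induced by words of `D`. -/
noncomputable def perms (_ : IsMinIdempotent φ D e) : Finset (Equiv.Perm {p // Leads φ e p p}) :=
  {g | ∃ w ∈ D, ∀ p, Leads φ (e * w * e) p.1 (g p).1 ∧ Sim φ D p.1 (g p).1}

lemma mem_perms {g : Equiv.Perm {p // Leads φ e p p}} : g ∈ he.perms ↔
    ∃ w ∈ D, ∀ p, Leads φ (e * w * e) p.1 (g p).1 ∧ Sim φ D p.1 (g p).1 := by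
  simp [perms]

include hφ in
lemma exists_mem_perms {w : W} (hw : w ∈ D) :
    ∃ g ∈ he.perms, ∀ p, Leads φ (e * w * e) p.1 (g p).1 := by
  have h := fun p : {p // Leads φ e p p} => he.exists_target hφ hw p.2
  choose t ht hs hl using h
  let σ : {p // Leads φ e p p} → {p // Leads φ e p p} := fun p => ⟨t p, ht p⟩
  have hinj : Function.Injective σ := by
    intro p p' hpp
    have h1 : t p = t p' := congrArg Subtype.val hpp
    exact Subtype.ext (he.source_unique hφ hw (ht p) p.2 (hs p) (hl p) p'.2 (h1 ▸ hs p')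
      (h1 ▸ hl p'))
  refine ⟨Equiv.ofBijective σ (Finite.injective_iff_bijective.1 hinj), ?_, hl⟩
  exact he.mem_perms.2 ⟨w, hw, fun p => ⟨hl p, hs p⟩⟩

include hφ in
-- Take the permutation induced by a word leading from `p` to `q`: uniqueness of targets forces the
-- image of `p` to be `q`.
lemma perms_transitive {p q : {p // Leads φ e p p}} (h : Sim φ D p.1 q.1) :
    ∃ g ∈ he.perms, g p = q := by
  obtain ⟨w, hw, hl⟩ := h.1
  obtain ⟨g, hg, hgl⟩ := he.exists_mem_perms hφ hw
  obtain ⟨w', hw', hs⟩ := he.mem_perms.1 hg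
  exact ⟨g, hg, Subtype.ext (he.target_unique hφ hw p.2 (g p).2 (hs p).2 (hgl p) q.2 h
    ((p.2.mul hl).mul q.2))⟩

lemma mul_mem_perms {g g' : Equiv.Perm {p // Leads φ e p p}} (hg : g ∈ he.perms)
    (hg' : g' ∈ he.perms) : g * g' ∈ he.perms := by
  obtain ⟨w, hw, h⟩ := he.mem_perms.1 hg
  obtain ⟨w', hw', h'⟩ := he.mem_perms.1 hg'
  refine he.mem_perms.2 ⟨w' * e * e * w, D.mul_mem (D.mul_mem (D.mul_mem hw' he.mem) he.mem) hw,
    fun p => ⟨?_, (h' p).2.trans (h _).2⟩⟩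
  have := (h' p).1.mul (h (g' p)).1
  simpa [mul_assoc] using this

lemma sum_perms_mul {g' : Equiv.Perm {p // Leads φ e p p}} (hg' : g' ∈ he.perms)
    (f : Equiv.Perm {p // Leads φ e p p} → ℕ) :
    ∑ g ∈ he.perms, f (g * g') = ∑ g ∈ he.perms, f g := by
  classical
  have hinj : Set.InjOn (fun g => g * g') (he.perms : Set (Equiv.Perm {p // Leads φ e p p})) :=
    fun a _ b _ h => mul_right_cancel h
  have himg : he.perms.image (fun g => g * g') = he.perms := by
    apply Finset.eq_of_subset_of_card_le
    · intro x hx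
      obtain ⟨g, hg, rfl⟩ := Finset.mem_image.1 hx
      exact he.mul_mem_perms hg hg'
    · rw [Finset.card_image_of_injOn hinj]
  conv_rhs => rw [← himg]
  rw [Finset.sum_image hinj]

/-- The number of returns, summed over the images of `p` under all permutations. -/
noncomputable def totalReturns (u : W) (p : {p // Leads φ e p p}) : ℕ :=
  ∑ g ∈ he.perms, he.returns u (g p).1

include hφ in
-- Right translation by a permutation carrying `p` to `q` merely reorders the sum.
lemma totalReturns_congr (u : W) {p q : {p // Leads φ e p p}} (h : Sim φ D p.1 q.1) :
    he.totalReturns u p = he.totalReturns u q := by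
  obtain ⟨g', hg', rfl⟩ := he.perms_transitive hφ h
  exact (he.sum_perms_mul hg' (fun g => he.returns u (g p).1)).symm

lemma returns_congr_sum (u : W) {p q : Q} (h : Sim φ D p q) :
    he.returns u q = ∑ x with Leads φ e x x ∧ Sim φ D p x, φ (e * u * e) q x := by
  unfold returns
  refine Finset.sum_congr (Finset.filter_congr fun x _ => ?_) fun _ _ => rfl
  exact and_congr_right fun _ => ⟨fun h' => h.trans h', fun h' => h.symm.trans h'⟩

lemma perms_apply_mul_returns_le (u : W) {w : W} {g : Equiv.Perm {p // Leads φ e p p}}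
    {q : {p // Leads φ e p p}} (h : Leads φ (e * w * e) q.1 (g q).1) {p : Q}
    (hs : Sim φ D p (g q).1) :
    he.returns u (g q).1 ≤
      ∑ x with Leads φ e x x ∧ Sim φ D p x, φ (e * w * e * (e * u * e)) q.1 x := by
  rw [he.returns_congr_sum u hs]
  refine Finset.sum_le_sum fun x _ => ?_
  have := mul_apply_le φ (e * w * e) (e * u * e) q.1 (g q).1 x
  exact (Nat.le_mul_of_pos_left _ h).trans this

include hφ in
-- The number of paths from `p` to the fixed states in its class is bounded over all words, since
-- each of these states leads back to `p`. Choose a word `z` attaining the maximum. If a random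
-- permutation followed by `u` multiplied paths by more than one on average, some extension of `z`
-- would exceed the maximum.
lemma totalReturns_le (u : W) (p : {p // Leads φ e p p}) :
    he.totalReturns u p ≤ he.perms.card := by
  classical
  set O : Finset Q := {x | Leads φ e x x ∧ Sim φ D p.1 x} with hO
  have hmem : ∀ {x}, x ∈ O ↔ Leads φ e x x ∧ Sim φ D p.1 x := by simp [hO]
  let mass : W → ℕ := fun z => ∑ q ∈ O, φ z p.1 q
  have hbdd : BddAbove (Set.range mass) := by
    refine ⟨O.card, ?_⟩
    rintro _ ⟨z, rfl⟩
    calc mass z ≤ ∑ q ∈ O, 1 := Finset.sum_le_sum fun q hq => by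
          obtain ⟨v, -, hv⟩ := (hmem.1 hq).2.2
          exact hφ.apply_le_one hv
      _ = O.card := by simp
  obtain ⟨z, hz⟩ := Nat.sSup_mem (Set.range_nonempty mass) hbdd
  have hmax : ∀ z', mass z' ≤ mass z := fun z' => hz ▸ le_csSup hbdd ⟨z', rfl⟩
  have hpos : 1 ≤ mass z := by
    refine le_trans ?_ (hmax 1)
    have : φ 1 p.1 p.1 ≤ mass 1 := Finset.single_le_sum (f := fun q => φ 1 p.1 q)
      (fun _ _ => Nat.zero_le _) (hmem.2 ⟨p.2, Sim.refl D p.1⟩)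
    simpa using this
  have hstep : ∀ g ∈ he.perms,
      ∑ q ∈ O, φ z p.1 q * (if h : Leads φ e q q then he.returns u (g ⟨q, h⟩).1 else 0) ≤ mass z := by
    intro g hg
    obtain ⟨w, hw, hgw⟩ := he.mem_perms.1 hg
    refine le_trans ?_ (hmax (z * (e * w * e * (e * u * e))))
    calc _ ≤ ∑ q ∈ O, φ z p.1 q * ∑ x ∈ O, φ (e * w * e * (e * u * e)) q x := by
          refine Finset.sum_le_sum fun q hq => Nat.mul_le_mul_left _ ?_
          obtain ⟨h1, h2⟩ := hmem.1 hq
          rw [dif_pos h1]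
          exact he.perms_apply_mul_returns_le u (q := ⟨q, h1⟩) (hgw ⟨q, h1⟩).1
            (h2.trans (hgw ⟨q, h1⟩).2)
      _ = ∑ x ∈ O, ∑ q ∈ O, φ z p.1 q * φ (e * w * e * (e * u * e)) q x := by
          simp_rw [Finset.mul_sum]
          exact Finset.sum_comm
      _ ≤ _ := Finset.sum_le_sum fun x _ => sum_mul_apply_le φ _ _ _ _ O
  have hsum := Finset.sum_le_sum hstep
  rw [Finset.sum_comm, Finset.sum_const, smul_eq_mul] at hsum
  have heq : ∀ q ∈ O, ∑ g ∈ he.perms, φ z p.1 q *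
      (if h : Leads φ e q q then he.returns u (g ⟨q, h⟩).1 else 0)
      = φ z p.1 q * he.totalReturns u p := by
    intro q hq
    obtain ⟨h1, h2⟩ := hmem.1 hq
    rw [he.totalReturns_congr hφ u (p := p) (q := ⟨q, h1⟩) h2]
    simp only [dif_pos h1, totalReturns, Finset.mul_sum]
  rw [Finset.sum_congr rfl heq, ← Finset.sum_mul] at hsum
  have h' : mass z * he.totalReturns u p ≤ mass z * he.perms.card := by
    rw [mul_comm _ he.perms.card]; exact hsum
  exact Nat.le_of_mul_le_mul_left h' hpos

include hφ in
-- Summed over all fixed states the upper bounds of `totalReturns_le` are attained by assumption,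
-- hence each of them is.
lemma totalReturns_eq {u : W}
    (hu : Fintype.card {p // Leads φ e p p} ≤ ∑ p : {p // Leads φ e p p}, he.returns u p.1)
    (p : {p // Leads φ e p p}) : he.totalReturns u p = he.perms.card := by
  have h1 : ∑ p, he.totalReturns u p = he.perms.card * ∑ p : {p // Leads φ e p p}, he.returns u p.1 := by
    unfold totalReturns
    rw [Finset.sum_comm, Finset.sum_congr rfl (fun g _ =>
      Equiv.sum_comp g (fun p => he.returns u p.1)), Finset.sum_const, smul_eq_mul]
  have h2 : ∑ p : {p // Leads φ e p p}, he.perms.card ≤ ∑ p, he.totalReturns u p := by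
    rw [h1]; simp only [Finset.sum_const, Finset.card_univ, smul_eq_mul]
    rw [mul_comm]
    exact Nat.mul_le_mul_left _ hu
  have h3 := (Finset.sum_eq_sum_iff_of_le (fun p _ => he.totalReturns_le hφ u p)).1
    (le_antisymm (Finset.sum_le_sum fun p _ => he.totalReturns_le hφ u p) h2)
  exact h3 p (Finset.mem_univ p)

variable {u : W} {k : ℕ} {p : ℕ → Q}

/-- A lower bound for the number of paths that start in `q`, pass through `n` random factors, and
end in a state equivalent to `p k`, up to normalization. -/
noncomputable def potential (p : ℕ → Q) (k n : ℕ) (q : Q) : ℕ :=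
  ∑ i ∈ Finset.range (k + 1), if Sim φ D (p i) q then n.choose (k - i) * he.perms.card ^ i else 0

lemma le_potential {i n : ℕ} (hi : i ≤ k) {q : Q} (h : Sim φ D (p i) q) :
    n.choose (k - i) * he.perms.card ^ i ≤ he.potential p k n q := by
  classical
  unfold potential
  have := Finset.single_le_sum (f := fun i => if Sim φ D (p i) q then
    n.choose (k - i) * he.perms.card ^ i else 0) (fun _ _ => Nat.zero_le _)
    (Finset.mem_range.2 (Nat.lt_succ_of_le hi))
  simpa [h] using this

lemma potential_eq (hns : ∀ i j, i < j → j ≤ k → ¬ Sim φ D (p i) (p j)) {i n : ℕ} (hi : i ≤ k)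
    {q : Q} (h : Sim φ D (p i) q) :
    he.potential p k n q = n.choose (k - i) * he.perms.card ^ i := by
  classical
  unfold potential
  rw [Finset.sum_eq_single i]
  · simp [h]
  · intro j hj hne
    rw [if_neg]
    intro h'
    have hj' : j ≤ k := Nat.lt_succ_iff.1 (Finset.mem_range.1 hj)
    rcases lt_or_gt_of_ne hne with h1 | h1
    · exact hns j i h1 hi (h'.trans h.symm)
    · exact hns i j h1 hj' (h.trans h'.symm)
  · intro h'; simp at h'; omega

include hφ in
-- This is Pascal's rule. Over all permutations, the paths that stay in the class of `p i` have
-- total weight at least `he.perms.card`. At least one permutation carries `q` to `p i`, from where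
-- `u` leads on to `p (i + 1)`, outside the class. Only one of the permutations is guaranteed to do
-- so, which is why the potential has the factor `he.perms.card ^ i`.
lemma perms_card_mul_potential_le
    (hu : Fintype.card {p // Leads φ e p p} ≤ ∑ p : {p // Leads φ e p p}, he.returns u p.1)
    (hp : ∀ i ≤ k, Leads φ e (p i) (p i))
    (hstep : ∀ i < k, Leads φ (e * u * e) (p i) (p (i + 1)))
    (hns : ∀ i j, i < j → j ≤ k → ¬ Sim φ D (p i) (p j))
    (wd : Equiv.Perm {p // Leads φ e p p} → W)
    (hwd : ∀ g ∈ he.perms, ∀ p, Leads φ (e * wd g * e) p.1 (g p).1 ∧ Sim φ D p.1 (g p).1)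
    (n : ℕ) {q : Q} (hq : Leads φ e q q) :
    he.perms.card * he.potential p k (n + 1) q ≤
      ∑ g ∈ he.perms, ∑ x with Leads φ e x x,
        φ (e * wd g * e * (e * u * e)) q x * he.potential p k n x := by
  classical
  by_cases hex : ∃ i ≤ k, Sim φ D (p i) q
  swap
  · have : he.potential p k (n + 1) q = 0 := by
      unfold potential
      refine Finset.sum_eq_zero fun i hi => if_neg fun h => hex ⟨i, ?_, h⟩
      exact Nat.lt_succ_iff.1 (Finset.mem_range.1 hi)
    simp [this]
  obtain ⟨i, hi, hs⟩ := hex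
  rw [he.potential_eq hns hi hs]
  set O : Finset Q := {x | Leads φ e x x ∧ Sim φ D (p i) x} with hO
  have hmem : ∀ {x}, x ∈ O ↔ Leads φ e x x ∧ Sim φ D (p i) x := by simp [hO]
  have hOsub : O ⊆ Finset.univ.filter fun x => Leads φ e x x := fun x hx =>
    Finset.mem_filter.2 ⟨Finset.mem_univ x, (hmem.1 hx).1⟩
  have hstay : he.perms.card ≤
      ∑ g ∈ he.perms, ∑ x ∈ O, φ (e * wd g * e * (e * u * e)) q x := by
    rw [← he.totalReturns_eq hφ hu ⟨q, hq⟩]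
    refine Finset.sum_le_sum fun g hg => ?_
    exact he.perms_apply_mul_returns_le u (q := ⟨q, hq⟩) (hwd g hg _).1
      (hs.trans (hwd g hg ⟨q, hq⟩).2)
  have hstay' : he.perms.card * (n.choose (k - i) * he.perms.card ^ i) ≤
      ∑ g ∈ he.perms, ∑ x ∈ O, φ (e * wd g * e * (e * u * e)) q x * he.potential p k n x := by
    calc _ ≤ (∑ g ∈ he.perms, ∑ x ∈ O, φ (e * wd g * e * (e * u * e)) q x) *
          (n.choose (k - i) * he.perms.card ^ i) := Nat.mul_le_mul_right _ hstay
      _ = ∑ g ∈ he.perms, ∑ x ∈ O, φ (e * wd g * e * (e * u * e)) q x *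
          (n.choose (k - i) * he.perms.card ^ i) := by simp_rw [Finset.sum_mul]
      _ ≤ _ := Finset.sum_le_sum fun g _ => Finset.sum_le_sum fun x hx =>
          Nat.mul_le_mul_left _ (he.le_potential hi (hmem.1 hx).2)
  rcases hi.eq_or_lt with rfl | hlt
  · simp only [Nat.sub_self, Nat.choose_zero_right] at hstay' ⊢
    exact hstay'.trans (Finset.sum_le_sum fun g _ =>
      Finset.sum_le_sum_of_subset hOsub)
  have hnot : p (i + 1) ∉ O := fun h => hns i (i + 1) (Nat.lt_succ_self i) hlt (hmem.1 h).2
  have hins : insert (p (i + 1)) O ⊆ Finset.univ.filter fun x => Leads φ e x x :=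
    Finset.insert_subset (by simpa using hp (i + 1) hlt) hOsub
  have hcross : n.choose (k - (i + 1)) * he.perms.card ^ (i + 1) ≤
      ∑ g ∈ he.perms, φ (e * wd g * e * (e * u * e)) q (p (i + 1)) *
        he.potential p k n (p (i + 1)) := by
    obtain ⟨g, hg, hgq⟩ := he.perms_transitive hφ (p := ⟨q, hq⟩) (q := ⟨p i, hp i hi⟩) hs.symm
    refine le_trans ?_ (Finset.single_le_sum (f := fun g => φ (e * wd g * e * (e * u * e)) q
      (p (i + 1)) * he.potential p k n (p (i + 1))) (fun _ _ => Nat.zero_le _) hg)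
    have h1 : 0 < φ (e * wd g * e * (e * u * e)) q (p (i + 1)) := by
      have := (hwd g hg ⟨q, hq⟩).1
      rw [hgq] at this
      exact this.mul (hstep i hlt)
    exact (he.le_potential hlt (Sim.refl D _)).trans (Nat.le_mul_of_pos_left _ h1)
  have hch : (n + 1).choose (k - i) = n.choose (k - (i + 1)) + n.choose (k - i) := by
    rw [show k - i = (k - (i + 1)) + 1 by omega, Nat.choose_succ_succ]
  calc _ = he.perms.card * (n.choose (k - i) * he.perms.card ^ i) +
        n.choose (k - (i + 1)) * he.perms.card ^ (i + 1) := by rw [hch]; ring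
    _ ≤ _ := Nat.add_le_add hstay' hcross
    _ = ∑ g ∈ he.perms, ∑ x ∈ insert (p (i + 1)) O,
        φ (e * wd g * e * (e * u * e)) q x * he.potential p k n x := by
      rw [← Finset.sum_add_distrib]
      refine Finset.sum_congr rfl fun g _ => ?_
      rw [Finset.sum_insert hnot, add_comm]
    _ ≤ _ := Finset.sum_le_sum fun g _ =>
      Finset.sum_le_sum_of_subset hins

include hφ in
/-- If the factor `u` can be repeated without losing paths, and leads along a chain of `k + 1`
pairwise inequivalent fixed states, then the number of paths grows like `n ^ k`. -/
theorem exists_choose_le_paths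
    (hu : Fintype.card {p // Leads φ e p p} ≤ ∑ p : {p // Leads φ e p p}, he.returns u p.1)
    (hp : ∀ i ≤ k, Leads φ e (p i) (p i))
    (hstep : ∀ i < k, Leads φ (e * u * e) (p i) (p (i + 1)))
    (hns : ∀ i j, i < j → j ≤ k → ¬ Sim φ D (p i) (p j))
    (len : W → ℕ) (hlen : ∀ v w, len (v * w) = len v + len w) :
    ∃ c C, ∀ n, ∃ z, n * len u ≤ len z ∧ len z ≤ n * c ∧
      n.choose k ≤ C * ∑ q with Sim φ D (p k) q, φ z (p 0) q := by
  have hex : ∀ g : Equiv.Perm {p // Leads φ e p p}, ∃ w, g ∈ he.perms →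
      ∀ p, Leads φ (e * w * e) p.1 (g p).1 ∧ Sim φ D p.1 (g p).1 := by
    intro g
    by_cases hg : g ∈ he.perms
    · obtain ⟨w, -, hw⟩ := he.mem_perms.1 hg
      exact ⟨w, fun _ => hw⟩
    · exact ⟨1, fun h => absurd h hg⟩
  choose wd hwd using hex
  let fac : Equiv.Perm {p // Leads φ e p p} → W := fun g => e * wd g * e * (e * u * e)
  let c := he.perms.sup fun g => len (fac g)
  have hlen1 : len 1 = 0 := by have := hlen 1 1; simp at this; exact this
  have hne : he.perms.Nonempty := by
    obtain ⟨g, hg, -⟩ := he.exists_mem_perms hφ D.one_mem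
    exact ⟨g, hg⟩
  let mass : ℕ → W → ℕ := fun n z => ∑ q with Leads φ e q q, φ z (p 0) q * he.potential p k n q
  have hnext : ∀ n z, ∃ g ∈ he.perms,
      mass (n + 1) z ≤ mass n (z * fac g) := by
    intro n z
    -- Derandomization: the inequality holds on average over the permutations, so some fixed factor
    -- achieves it.
    apply Finset.exists_le_of_sum_le hne
    rw [Finset.sum_const, smul_eq_mul]
    calc he.perms.card * mass (n + 1) z
        = ∑ q with Leads φ e q q,
            φ z (p 0) q * (he.perms.card * he.potential p k (n + 1) q) := by
          simp only [mass, Finset.mul_sum]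
          exact Finset.sum_congr rfl fun _ _ => by ring
      _ ≤ ∑ q with Leads φ e q q, φ z (p 0) q *
            ∑ g ∈ he.perms, ∑ x with Leads φ e x x, φ (fac g) q x * he.potential p k n x := by
          refine Finset.sum_le_sum fun q hq => Nat.mul_le_mul_left _ ?_
          exact he.perms_card_mul_potential_le hφ hu hp hstep hns wd hwd n
            (Finset.mem_filter.1 hq).2
      _ = ∑ g ∈ he.perms, ∑ x with Leads φ e x x, (∑ q with Leads φ e q q, φ z (p 0) q * φ (fac g) q x) *
            he.potential p k n x := by
          simp_rw [Finset.mul_sum, Finset.sum_mul]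
          rw [Finset.sum_comm]
          refine Finset.sum_congr rfl fun g _ => ?_
          rw [Finset.sum_comm]
          exact Finset.sum_congr rfl fun _ _ => Finset.sum_congr rfl fun _ _ => by ring
      _ ≤ _ := Finset.sum_le_sum fun g _ => Finset.sum_le_sum fun x _ =>
          Nat.mul_le_mul_right _ (sum_mul_apply_le φ _ _ _ _ _)
  have hmain : ∀ n z, ∃ z', n * len u ≤ len z' ∧ len z' ≤ n * c ∧ mass n z ≤ mass 0 (z * z') := by
    intro n
    induction n with
    | zero => exact fun z => ⟨1, by simp, by simp [hlen1], by simp⟩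
    | succ n ih =>
      intro z
      obtain ⟨g, hg, hgm⟩ := hnext n z
      obtain ⟨z', h1, h2, h3⟩ := ih (z * fac g)
      have hc : len (fac g) ≤ c := Finset.le_sup (f := fun g => len (fac g)) hg
      have hu' : len u ≤ len (fac g) := by simp only [fac, hlen]; omega
      refine ⟨fac g * z', ?_, ?_, ?_⟩
      · rw [hlen, add_mul, one_mul]; omega
      · rw [hlen, add_mul, one_mul]; omega
      · rw [← mul_assoc]; exact hgm.trans h3
  refine ⟨c, he.perms.card ^ k, fun n => ?_⟩
  obtain ⟨z, h1, h2, h3⟩ := hmain n 1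
  refine ⟨z, h1, h2, ?_⟩
  have hlow : n.choose k ≤ mass n 1 := by
    have h4 : φ 1 (p 0) (p 0) * he.potential p k n (p 0) ≤ mass n 1 :=
      Finset.single_le_sum (f := fun q => φ 1 (p 0) q * he.potential p k n q)
        (fun _ _ => Nat.zero_le _) (Finset.mem_filter.2 ⟨Finset.mem_univ _, hp 0 (Nat.zero_le k)⟩)
    have h5 := he.le_potential (p := p) (n := n) (Nat.zero_le k) (Sim.refl D (p 0))
    simp only [map_one, Matrix.one_apply_eq, one_mul] at h4
    simp only [Nat.sub_zero, pow_zero, mul_one] at h5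
    exact h5.trans h4
  refine (hlow.trans h3).trans ?_
  rw [one_mul, Finset.mul_sum, Finset.sum_filter]
  refine (Finset.sum_le_sum_of_subset (Finset.filter_subset _ _)).trans
    (Finset.sum_le_sum fun q _ => ?_)
  split_ifs with hs
  · rw [he.potential_eq hns le_rfl hs]; simp [mul_comm]
  -- With no factors left, `Nat.choose 0 (k - i)` vanishes unless `i = k`, so only paths ending in
  -- the class of `p k` count.
  · have : he.potential p k 0 q = 0 := by
      unfold potential
      refine Finset.sum_eq_zero fun i hi => ?_
      have hi' := Finset.mem_range.1 hi
      split_ifs with hsi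
      · have : i < k := lt_of_le_of_ne (by omega) (fun h => hs (h ▸ hsi))
        rw [Nat.choose_eq_zero_of_lt (by omega), zero_mul]
      · rfl
    simp [this]

end Growth

end IsMinIdempotent

/-! ### Large rectangles contain many intersecting pairs -/

section Corruption

variable {m q k : ℕ}

/-- The graphs of `x` and `y` intersect. -/
def Agree (x y : Fin m → Fin q) : Prop := ∃ l, x l = y l

instance (x y : Fin m → Fin q) : Decidable (Agree x y) := inferInstanceAs (Decidable (∃ _, _))

/-- Exponential moments: each column hits `V l` with probability at most `1/16`, so `16` to the
number of hits has mean at most `2 ^ m`. At least `m / 2` hits make it at least `4 ^ m`. -/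
lemma card_often_mem_mul_le (hq : q = 16 * k) (V : Fin m → Finset (Fin q))
    (hV : ∀ l, (V l).card ≤ k) :
    (Finset.univ.filter fun x : Fin m → Fin q =>
      m ≤ 2 * (Finset.univ.filter fun l => x l ∈ V l).card).card * 2 ^ m ≤ q ^ m := by
  have h1 : ∑ x : Fin m → Fin q, 16 ^ (Finset.univ.filter fun l => x l ∈ V l).card
      ≤ (2 * q) ^ m := by
    calc _ = ∑ x : Fin m → Fin q, ∏ l, if x l ∈ V l then 16 else 1 := by
          refine Finset.sum_congr rfl fun x _ => ?_
          rw [← Finset.prod_filter, Finset.prod_const]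
      _ = ∏ l, ∑ v : Fin q, if v ∈ V l then 16 else 1 :=
          (Fintype.prod_sum fun l (v : Fin q) => if v ∈ V l then 16 else 1).symm
      _ ≤ ∏ _l : Fin m, 2 * q := by
          refine Finset.prod_le_prod' fun l _ => ?_
          calc ∑ v : Fin q, (if v ∈ V l then 16 else 1)
              = ∑ v : Fin q, (1 + if v ∈ V l then 15 else 0) :=
                Finset.sum_congr rfl fun v _ => by split_ifs <;> rfl
            _ = q + (V l).card * 15 := by
                rw [Finset.sum_add_distrib, ← Finset.sum_filter]; simp
            _ ≤ 2 * q := by have := hV l; omega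
      _ = (2 * q) ^ m := by simp
  have h2 : (Finset.univ.filter fun x : Fin m → Fin q =>
      m ≤ 2 * (Finset.univ.filter fun l => x l ∈ V l).card).card * 4 ^ m ≤ (2 * q) ^ m := by
    refine le_trans ?_ h1
    rw [← smul_eq_mul, ← Finset.sum_const]
    refine (Finset.sum_le_sum fun x hx => ?_).trans
      (Finset.sum_le_sum_of_subset (Finset.filter_subset _ _))
    rw [show 16 = 4 ^ 2 by norm_num, ← pow_mul]
    exact Nat.pow_le_pow_right (by norm_num) (Finset.mem_filter.1 hx).2
  rw [show 4 = 2 * 2 by norm_num, mul_pow, mul_pow, mul_comm (2 ^ m) (q ^ m), ← mul_assoc] at h2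
  exact Nat.le_of_mul_le_mul_right h2 (by positivity)

/-- Choose greedily. The earlier functions occupy at most `k = q / 16` values in each column, so by
`card_often_mem_mul_le` the functions with half of their graph among these values cannot exhaust
`A`. -/
lemma exists_spread_sequence (hq : q = 16 * k) {A : Finset (Fin m → Fin q)}
    (hA : q ^ m < A.card * 2 ^ m) :
    ∃ x : ℕ → Fin m → Fin q, ∀ i < k, x i ∈ A ∧
      m ≤ 2 * (Finset.univ.filter fun l => ∀ j < i, x j l ≠ x i l).card := by
  suffices h : ∀ n ≤ k, ∃ x : ℕ → Fin m → Fin q, ∀ i < n, x i ∈ A ∧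
      m ≤ 2 * (Finset.univ.filter fun l => ∀ j < i, x j l ≠ x i l).card from h k le_rfl
  intro n
  induction n with
  | zero =>
    intro _
    obtain ⟨a, -⟩ : A.Nonempty := by
      rw [← Finset.card_pos]; by_contra h0; simp at h0; simp [h0] at hA
    exact ⟨fun _ => a, by simp⟩
  | succ n ih =>
    intro hn
    obtain ⟨x, hx⟩ := ih (by omega)
    let V : Fin m → Finset (Fin q) := fun l => (Finset.range n).image fun j => x j l
    have hV : ∀ l, (V l).card ≤ k := fun l =>
      Finset.card_image_le.trans (by simp; omega)
    have hcount := card_often_mem_mul_le hq V hV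
    obtain ⟨a, ha, hna⟩ : ∃ a ∈ A, ¬ m ≤ 2 * (Finset.univ.filter fun l => a l ∈ V l).card := by
      by_contra hcon
      push Not at hcon
      have hsub : A ⊆ Finset.univ.filter fun x : Fin m → Fin q =>
          m ≤ 2 * (Finset.univ.filter fun l => x l ∈ V l).card := fun a ha => by
        simpa using hcon a ha
      have := Nat.mul_le_mul_right (2 ^ m) (Finset.card_le_card hsub)
      omega
    refine ⟨Function.update x n a, fun i hi => ?_⟩
    rcases Nat.lt_succ_iff_lt_or_eq.1 hi with hlt | rfl
    · have h1 : Function.update x n a i = x i := Function.update_of_ne hlt.ne _ _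
      have h2 : ∀ j < i, Function.update x n a j = x j := fun j hj =>
        Function.update_of_ne (by omega) _ _
      rw [h1]
      refine ⟨(hx i hlt).1, (hx i hlt).2.trans_eq ?_⟩
      congr 2
      ext l
      simp +contextual [h2]
    · rw [Function.update_self]
      refine ⟨ha, ?_⟩
      have h2 : ∀ j < i, Function.update x i a j = x j := fun j hj =>
        Function.update_of_ne (by omega) _ _
      have h3 : (Finset.univ.filter fun l => ∀ j < i, Function.update x i a j l ≠ a l) =
          Finset.univ.filter fun l => ¬ a l ∈ V l := by
        ext l
        simp +contextual [h2, V]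
      rw [h3]
      have := Finset.card_filter_add_card_filter_not (s := (Finset.univ : Finset (Fin m)))
        (fun l => a l ∈ V l)
      rw [Finset.card_univ, Fintype.card_fin] at this
      omega

/-- Each `x i` has at least `m / 2` points outside the earlier graphs, so the graphs with index in
`K` cover at least `K.card * m / 2 ≥ 2 * k * q` points. A random `y` avoids them with probability at
most `∏ (1 - (V l).card / q) ≤ exp (-2 * k) ≤ 4 ^ (-k)`. -/
lemma card_avoiding_mul_le (hq : q = 16 * k) (hk : 0 < k) (hm : 8 * q ≤ m)
    {x : ℕ → Fin m → Fin q}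
    (hx : ∀ i < k, m ≤ 2 * (Finset.univ.filter fun l => ∀ j < i, x j l ≠ x i l).card)
    {K : Finset ℕ} (hK : K ⊆ Finset.range k) (hK' : k ≤ 2 * K.card) :
    (Finset.univ.filter fun y : Fin m → Fin q => ∀ i ∈ K, ¬ Agree (x i) y).card * 4 ^ k ≤ q ^ m := by
  let V : Fin m → Finset (Fin q) := fun l => K.image fun i => x i l
  have hset : (Finset.univ.filter fun y : Fin m → Fin q => ∀ i ∈ K, ¬ Agree (x i) y) =
      Fintype.piFinset fun l => (V l)ᶜ := by
    ext y
    simp only [Finset.mem_filter, Finset.mem_univ, true_and, Fintype.mem_piFinset,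
      Finset.mem_compl, V, Finset.mem_image, Agree, not_exists, not_and]
    exact ⟨fun h l i hi => h i hi l, fun h i hi l => h l i hi⟩
  have hVcard : K.card * m ≤ 2 * ∑ l, (V l).card := by
    calc K.card * m = ∑ i ∈ K, m := by simp
      _ ≤ ∑ i ∈ K, 2 * (Finset.univ.filter fun l => ∀ j < i, x j l ≠ x i l).card :=
          Finset.sum_le_sum fun i hi => hx i (Finset.mem_range.1 (hK hi))
      _ = 2 * ∑ l, (K.filter fun i => ∀ j < i, x j l ≠ x i l).card := by
          rw [← Finset.mul_sum]
          congr 1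
          simp only [Finset.card_filter]
          exact Finset.sum_comm
      _ ≤ _ := by
          refine Nat.mul_le_mul_left _ (Finset.sum_le_sum fun l _ => ?_)
          refine Finset.card_le_card_of_injOn (fun i => x i l) ?_ ?_
          · intro i hi
            exact Finset.mem_image_of_mem _ (Finset.mem_filter.1 hi).1
          · intro i hi j hj hij
            have hi' := (Finset.mem_filter.1 hi).2
            have hj' := (Finset.mem_filter.1 hj).2
            rcases lt_trichotomy i j with h | h | h
            · exact absurd hij (hj' i h)
            · exact h
            · exact absurd hij.symm (hi' j h)
  have hq0 : (0 : ℝ) < q := by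
    have : 0 < q := by omega
    exact_mod_cast this
  rw [hset, Fintype.card_piFinset]
  have hreal : ((∏ l, ((V l)ᶜ).card : ℕ) : ℝ) ≤ (q : ℝ) ^ m * Real.exp (-(2 * k)) := by
    calc ((∏ l, ((V l)ᶜ).card : ℕ) : ℝ) ≤ ∏ l : Fin m, ((q : ℝ) * Real.exp (-((V l).card / q))) := by
          rw [Nat.cast_prod]
          refine Finset.prod_le_prod (fun _ _ => Nat.cast_nonneg _) fun l _ => ?_
          have hle : (V l).card ≤ q := by
            simpa using Finset.card_le_univ (V l)
          rw [Finset.card_compl, Fintype.card_fin, Nat.cast_sub hle]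
          have := Real.add_one_le_exp (-((V l).card / q : ℝ))
          calc ((q : ℝ) - (V l).card) = q * (-((V l).card / q) + 1) := by field_simp; ring
            _ ≤ _ := by gcongr
      _ = (q : ℝ) ^ m * Real.exp (∑ l, -((V l).card / q : ℝ)) := by
          rw [Finset.prod_mul_distrib, Real.exp_sum]; simp
      _ ≤ _ := by
          gcongr
          rw [Finset.sum_neg_distrib, neg_le_neg_iff, ← Finset.sum_div, le_div_iff₀ hq0]
          have h1 : 4 * (k * (8 * q)) ≤ 16 * ∑ l, (V l).card := by
            calc 4 * (k * (8 * q)) ≤ 4 * (2 * K.card * m) := by gcongr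
              _ = 8 * (K.card * m) := by ring
              _ ≤ 8 * (2 * ∑ l, (V l).card) := by gcongr
              _ = _ := by ring
          have h2 : 2 * k * q ≤ ∑ l, (V l).card := by nlinarith
          exact_mod_cast h2
  have hexp : Real.exp (-(2 * k)) * 4 ^ k ≤ 1 := by
    rw [Real.exp_neg, inv_mul_le_iff₀ (Real.exp_pos _), mul_one,
      show (2 : ℝ) * k = k * 2 by ring, Real.exp_nat_mul]
    gcongr
    have := Real.add_one_le_exp (1 : ℝ)
    rw [show (2 : ℝ) = 1 + 1 by norm_num, Real.exp_add]
    nlinarith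
  have : ((∏ l, ((V l)ᶜ).card : ℕ) : ℝ) * 4 ^ k ≤ (q : ℝ) ^ m := by
    calc _ ≤ (q : ℝ) ^ m * Real.exp (-(2 * k)) * 4 ^ k := by gcongr
      _ = (q : ℝ) ^ m * (Real.exp (-(2 * k)) * 4 ^ k) := by ring
      _ ≤ (q : ℝ) ^ m * 1 := by gcongr
      _ = _ := mul_one _
  exact_mod_cast this

/-- A large rectangle contains a constant fraction of intersecting pairs. -/
theorem rectangle_corruption (hq : q = 16 * k) (hk : 0 < k) (hm : 8 * q ≤ m)
    (A B : Finset (Fin m → Fin q)) :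
    A.card * 2 ^ k ≤ 2 * q ^ m ∨ B.card * 2 ^ k ≤ 2 * q ^ m ∨
      A.card * B.card ≤ 8 * ∑ x ∈ A, (B.filter fun y => Agree x y).card := by
  by_contra! hcon
  obtain ⟨hA, hB, hAB⟩ := hcon
  -- By Markov's inequality more than half of `A` agrees with at most a quarter of `B`. The spread
  -- sequence is taken from this part.
  let A' := A.filter fun x => 4 * (B.filter fun y => Agree x y).card ≤ B.card
  have hBpos : 0 < B.card := by
    by_contra h0
    have : B.card = 0 := by omega
    simp [this] at hB
  have hA' : A.card < 2 * A'.card := by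
    have h1 := Finset.card_filter_add_card_filter_not (s := A)
      (fun x => 4 * (B.filter fun y => Agree x y).card ≤ B.card)
    have h2 : (A.filter fun x => ¬ 4 * (B.filter fun y => Agree x y).card ≤ B.card).card * B.card
        ≤ 4 * ∑ x ∈ A, (B.filter fun y => Agree x y).card := by
      rw [Finset.mul_sum, ← smul_eq_mul, ← Finset.sum_const]
      refine (Finset.sum_le_sum fun x hx => ?_).trans
        (Finset.sum_le_sum_of_subset (Finset.filter_subset _ _))
      exact (not_le.1 (Finset.mem_filter.1 hx).2).le
    change A'.card + _ = _ at h1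
    nlinarith
  have hkm : 2 ^ k ≤ 2 ^ m := Nat.pow_le_pow_right (by norm_num) (by omega)
  have hAm : A.card * 2 ^ k ≤ 2 * A'.card * 2 ^ m := Nat.mul_le_mul hA'.le hkm
  obtain ⟨x, hx⟩ := exists_spread_sequence (A := A') hq (by linarith)
  let d : (Fin m → Fin q) → ℕ := fun y => ((Finset.range k).filter fun i => Agree (x i) y).card
  have hd : 4 * ∑ y ∈ B, d y ≤ k * B.card := by
    calc 4 * ∑ y ∈ B, d y = ∑ i ∈ Finset.range k, 4 * (B.filter fun y => Agree (x i) y).card := by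
          rw [← Finset.mul_sum]
          congr 1
          simp only [d, Finset.card_filter]
          exact Finset.sum_comm
      _ ≤ ∑ i ∈ Finset.range k, B.card := Finset.sum_le_sum fun i hi =>
          (Finset.mem_filter.1 (hx i (Finset.mem_range.1 hi)).1).2
      _ = _ := by simp
  -- A random `y ∈ B` agrees on average with at most a quarter of the `x i`, so at least half of `B`
  -- agrees with at most half of them.
  let B' := B.filter fun y => 2 * d y ≤ k
  have hB' : B.card ≤ 2 * B'.card := by
    have h1 := Finset.card_filter_add_card_filter_not (s := B) (fun y => 2 * d y ≤ k)
    have h2 : (B.filter fun y => ¬ 2 * d y ≤ k).card * k ≤ 2 * ∑ y ∈ B, d y := by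
      rw [Finset.mul_sum, ← smul_eq_mul, ← Finset.sum_const]
      refine (Finset.sum_le_sum fun x hx => ?_).trans
        (Finset.sum_le_sum_of_subset (Finset.filter_subset _ _))
      exact (not_le.1 (Finset.mem_filter.1 hx).2).le
    change B'.card + _ = _ at h1
    have h3 : (2 * (B.filter fun y => ¬ 2 * d y ≤ k).card) * k ≤ B.card * k := by nlinarith
    have := Nat.le_of_mul_le_mul_right h3 hk
    omega
  -- The index sets that some `y ∈ B'` may avoid. The union bound over them costs `2 ^ k` against
  -- the gain `4 ^ k`.
  let 𝒦 := (Finset.range k).powerset.filter fun K => k ≤ 2 * K.card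
  have hcover : B' ⊆ 𝒦.biUnion fun K =>
      Finset.univ.filter fun y : Fin m → Fin q => ∀ i ∈ K, ¬ Agree (x i) y := by
    intro y hy
    have hy' := (Finset.mem_filter.1 hy).2
    rw [Finset.mem_biUnion]
    refine ⟨(Finset.range k).filter fun i => ¬ Agree (x i) y, ?_, ?_⟩
    · have := Finset.card_filter_add_card_filter_not (s := Finset.range k)
        (fun i => Agree (x i) y)
      rw [Finset.card_range] at this
      simp only [𝒦, Finset.mem_filter, Finset.mem_powerset, Finset.filter_subset, true_and]
      change d y + _ = _ at this
      omega
    · simp +contextual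
  have h𝒦 : 𝒦.card ≤ 2 ^ k := by
    refine (Finset.card_filter_le _ _).trans ?_
    simp
  have hfin : B'.card * 4 ^ k ≤ 2 ^ k * q ^ m := by
    calc B'.card * 4 ^ k ≤ (∑ K ∈ 𝒦, (Finset.univ.filter fun y : Fin m → Fin q =>
            ∀ i ∈ K, ¬ Agree (x i) y).card) * 4 ^ k :=
          Nat.mul_le_mul_right _ ((Finset.card_le_card hcover).trans Finset.card_biUnion_le)
      _ = ∑ K ∈ 𝒦, (Finset.univ.filter fun y : Fin m → Fin q =>
            ∀ i ∈ K, ¬ Agree (x i) y).card * 4 ^ k := Finset.sum_mul ..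
      _ ≤ ∑ K ∈ 𝒦, q ^ m := Finset.sum_le_sum fun K hK => by
          rw [Finset.mem_filter, Finset.mem_powerset] at hK
          exact card_avoiding_mul_le hq hk hm (fun i hi => (hx i hi).2) hK.1 hK.2
      _ ≤ _ := by rw [Finset.sum_const, smul_eq_mul]; gcongr
  rw [show 4 = 2 * 2 by norm_num, mul_pow, ← mul_assoc, mul_comm (2 ^ k) (q ^ m)] at hfin
  have := Nat.le_of_mul_le_mul_right hfin (by positivity)
  nlinarith

end Corruption

/-! ### Weighted path counts as matrix powers -/

section Averaging

lemma sum_pow_eq_sum_list_prod {R ι : Type*} [Semiring R] [Fintype ι] (g : ι → R) (t : ℕ) :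
    (∑ i, g i) ^ t = ∑ f : Fin t → ι, (List.ofFn fun j => g (f j)).prod := by
  classical
  induction t with
  | zero => simp
  | succ t ih =>
    rw [pow_succ', ih, Finset.sum_mul_sum, ← Finset.sum_product',
      ← (Fin.consEquiv fun _ : Fin (t + 1) => ι).sum_comp]
    refine Finset.sum_congr rfl fun x _ => ?_
    simp [Fin.consEquiv]

lemma list_prod_smul {R A ι : Type*} [CommSemiring R] [Semiring A] [Algebra R A] (c : ι → R)
    (M : ι → A) (l : List ι) :
    (l.map fun i => c i • M i).prod = (l.map c).prod • (l.map M).prod := by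
  induction l with
  | nil => simp
  | cons a l ih => simp [ih, mul_smul, smul_comm (c a)]

lemma neg_le_mul_of_bounds {x y l h d g : ℝ} (hl : 0 ≤ l) (hh : 0 ≤ h) (hd : 0 ≤ d) (hg : 0 ≤ g)
    (hx : -l ≤ x) (hx' : x ≤ h) (hy : -d ≤ y) (hy' : y ≤ g) : -(l * g + h * d) ≤ x * y := by
  rcases le_total 0 x with h1 | h1 <;> rcases le_total 0 y with h2 | h2
  · nlinarith [mul_nonneg h1 h2, mul_nonneg hl hg, mul_nonneg hh hd]
  · nlinarith [mul_nonneg hl hg, mul_nonneg h1 (neg_nonneg.2 h2)]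
  · nlinarith [mul_nonneg hh hd, mul_nonneg h2 (neg_nonneg.2 h1)]
  · nlinarith [mul_nonneg (neg_nonneg.2 h1) (neg_nonneg.2 h2), mul_nonneg hl hg, mul_nonneg hh hd]

/-- A negative term in an entry of the power needs a negative entry in one of its `t` factors, which
costs a factor `η`. Hence the error is linear in `t` and in `η`. -/
lemma pow_entries_bound {Q : Type*} [Fintype Q] [DecidableEq Q] {M : Matrix Q Q ℝ} {Γ η : ℝ}
    (hΓ : 0 ≤ Γ) (hη : 0 ≤ η) (hη' : η ≤ 1) (hlow : ∀ a b, -(Γ * η) ≤ M a b)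
    (hup : ∀ a b, M a b ≤ Γ) (t : ℕ) :
    ∀ a b, -(t * (Fintype.card Q * Γ) ^ t * η) ≤ (M ^ t) a b ∧
      |(M ^ t) a b| ≤ (Fintype.card Q * Γ) ^ t := by
  have habs : ∀ a b, |M a b| ≤ Γ := fun a b =>
    abs_le.2 ⟨by nlinarith [hlow a b], hup a b⟩
  induction t with
  | zero =>
    intro a b
    by_cases h : a = b <;> simp [h]
  | succ t ih =>
    intro a b
    have hG : 0 ≤ (Fintype.card Q * Γ) ^ t := by positivity
    rw [pow_succ M, Matrix.mul_apply]
    constructor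
    · have : ∑ _c : Q, -(t * (Fintype.card Q * Γ) ^ t * η * Γ + (Fintype.card Q * Γ) ^ t * (Γ * η))
          ≤ ∑ c, (M ^ t) a c * M c b := by
        refine Finset.sum_le_sum fun c _ => ?_
        exact neg_le_mul_of_bounds (by positivity) hG (by positivity) hΓ (ih a c).1
          (abs_le.1 (ih a c).2).2 (hlow c b) (hup c b)
      refine le_trans (le_of_eq ?_) this
      rw [Finset.sum_const, Finset.card_univ, nsmul_eq_mul, pow_succ]
      push_cast
      ring
    · refine (Finset.abs_sum_le_sum_abs _ _).trans ?_
      calc ∑ c, |(M ^ t) a c * M c b| ≤ ∑ _c : Q, (Fintype.card Q * Γ) ^ t * Γ := by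
            refine Finset.sum_le_sum fun c _ => ?_
            rw [abs_mul]
            exact mul_le_mul (ih a c).2 (habs c b) (abs_nonneg _) hG
        _ = _ := by rw [Finset.sum_const, Finset.card_univ, nsmul_eq_mul, pow_succ]; ring

variable {m q k : ℕ}

/-- The weight of a pair: `1` if the graphs intersect, `-1/8` otherwise. -/
noncomputable def pairWeight (i : (Fin m → Fin q) × (Fin m → Fin q)) : ℝ :=
  if Agree i.1 i.2 then 1 else -(1 / 8)

lemma rectangle_weight (A B : Finset (Fin m → Fin q)) :
    ∑ x ∈ A, ∑ y ∈ B, pairWeight (x, y) =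
      9 / 8 * ((∑ x ∈ A, (B.filter fun y => Agree x y).card : ℕ) : ℝ) - A.card * B.card / 8 := by
  have : ∀ x y : Fin m → Fin q, pairWeight (x, y) = 9 / 8 * (if Agree x y then 1 else 0) - 1 / 8 := by
    intro x y; unfold pairWeight; dsimp only; split_ifs <;> norm_num
  simp only [this, Finset.sum_sub_distrib, ← Finset.mul_sum, Nat.cast_sum, Finset.card_filter,
    Nat.cast_ite, Nat.cast_one, Nat.cast_zero, Finset.sum_const, nsmul_eq_mul]
  ring

lemma rectangle_weight_le (A B : Finset (Fin m → Fin q)) :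
    ∑ x ∈ A, ∑ y ∈ B, pairWeight (x, y) ≤ (q : ℝ) ^ (2 * m) := by
  have h0 : ∀ x y : Fin m → Fin q, pairWeight (x, y) ≤ 1 := by
    intro x y; unfold pairWeight; split_ifs <;> norm_num
  have hA : (A.card : ℝ) ≤ (q : ℝ) ^ m := by exact_mod_cast (by simpa using Finset.card_le_univ A)
  have hB : (B.card : ℝ) ≤ (q : ℝ) ^ m := by exact_mod_cast (by simpa using Finset.card_le_univ B)
  calc _ ≤ ∑ x ∈ A, ∑ y ∈ B, (1 : ℝ) :=
        Finset.sum_le_sum fun x _ => Finset.sum_le_sum fun y _ => h0 x y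
    _ = A.card * B.card := by simp
    _ ≤ (q : ℝ) ^ m * (q : ℝ) ^ m := by gcongr
    _ = _ := by rw [two_mul, pow_add]

/-- The weight `-1/8` of disjoint pairs matches the constant `8` of `rectangle_corruption`: a
rectangle with that many intersecting pairs has nonnegative weight, and all others are tiny. -/
lemma neg_le_rectangle_weight (hq : q = 16 * k) (hk : 0 < k) (hm : 8 * q ≤ m)
    (A B : Finset (Fin m → Fin q)) :
    -((q : ℝ) ^ (2 * m) * (1 / 2) ^ k) ≤ ∑ x ∈ A, ∑ y ∈ B, pairWeight (x, y) := by
  rw [rectangle_weight]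
  have hA : (A.card : ℝ) ≤ (q : ℝ) ^ m := by exact_mod_cast (by simpa using Finset.card_le_univ A)
  have hB : (B.card : ℝ) ≤ (q : ℝ) ^ m := by exact_mod_cast (by simpa using Finset.card_le_univ B)
  have hagr : (0 : ℝ) ≤ ((∑ x ∈ A, (B.filter fun y => Agree x y).card : ℕ) : ℝ) := Nat.cast_nonneg _
  have hsmall : ∀ {n : ℕ}, n * 2 ^ k ≤ 2 * q ^ m → (n : ℝ) ≤ 2 * (q : ℝ) ^ m * (1 / 2) ^ k := by
    intro n hn
    have : (n : ℝ) * 2 ^ k ≤ 2 * (q : ℝ) ^ m := by exact_mod_cast hn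
    rw [one_div, inv_pow, ← div_eq_mul_inv, le_div_iff₀ (by positivity)]
    exact this
  have hV : (q : ℝ) ^ (2 * m) = (q : ℝ) ^ m * (q : ℝ) ^ m := by rw [two_mul, pow_add]
  have hmul : ∀ {a b : ℝ}, 0 ≤ a → 0 ≤ b → a ≤ 2 * (q : ℝ) ^ m * (1 / 2) ^ k → b ≤ (q : ℝ) ^ m →
      a * b ≤ 8 * ((q : ℝ) ^ (2 * m) * (1 / 2) ^ k) := by
    intro a b ha hb h1 h2
    have h3 : a * b ≤ 2 * (q : ℝ) ^ m * (1 / 2) ^ k * (q : ℝ) ^ m := by gcongr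
    have h4 : 0 ≤ (q : ℝ) ^ m * (q : ℝ) ^ m * (1 / 2) ^ k := by positivity
    rw [hV]; linarith
  rcases rectangle_corruption hq hk hm A B with h | h | h
  · have := hmul (Nat.cast_nonneg A.card) (Nat.cast_nonneg B.card) (hsmall h) hB
    linarith
  · have := hmul (Nat.cast_nonneg B.card) (Nat.cast_nonneg A.card) (hsmall h) hA
    linarith
  · have h' : (A.card : ℝ) * B.card ≤ 8 * ((∑ x ∈ A, (B.filter fun y => Agree x y).card : ℕ) : ℝ) := by
      exact_mod_cast h
    have : (0 : ℝ) ≤ (q : ℝ) ^ (2 * m) * (1 / 2) ^ k := by positivity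
    linarith

variable {Q : Type*} [Fintype Q] [DecidableEq Q]

/-- The number of paths on a sequence of pairs, from the states selected by `I` to those selected
by `F`. -/
def pairPaths (P R : (Fin m → Fin q) → Matrix Q Q ℕ) (I F : Q → ℕ) {t : ℕ}
    (u : Fin t → (Fin m → Fin q) × (Fin m → Fin q)) : ℕ :=
  ∑ a, ∑ b, I a * (List.ofFn fun j => P (u j).1 * R (u j).2).prod a b * F b

/-- Weights and transition matrices both multiply along a sequence, so the sum over all sequences
factors into a power of one weighted matrix. -/
lemma weighted_pairPaths (P R : (Fin m → Fin q) → Matrix Q Q ℕ) (I F : Q → ℕ) (t : ℕ) :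
    ∑ u : Fin t → (Fin m → Fin q) × (Fin m → Fin q),
      (∏ j, pairWeight (u j)) * (pairPaths P R I F u : ℝ) =
    ∑ a, ∑ b, (I a : ℝ) * ((∑ i : (Fin m → Fin q) × (Fin m → Fin q), pairWeight i •
      ((P i.1 * R i.2).map (Nat.cast : ℕ → ℝ))) ^ t) a b * F b := by
  rw [sum_pow_eq_sum_list_prod]
  have h1 : ∀ u : Fin t → (Fin m → Fin q) × (Fin m → Fin q),
      (List.ofFn fun j => pairWeight (u j) • ((P (u j).1 * R (u j).2).map (Nat.cast : ℕ → ℝ))).prod =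
      (∏ j, pairWeight (u j)) • ((List.ofFn fun j => P (u j).1 * R (u j).2).prod.map
        (Nat.cast : ℕ → ℝ)) := by
    intro u
    have h2 := list_prod_smul (R := ℝ) (fun j => pairWeight (u j))
      (fun j => (P (u j).1 * R (u j).2).map (Nat.cast : ℕ → ℝ)) (List.finRange t)
    rw [List.ofFn_eq_map, List.ofFn_eq_map, h2, ← List.ofFn_eq_map, List.prod_ofFn]
    congr 1
    have h3 := map_list_prod (Nat.castRingHom ℝ).mapMatrix
      ((List.finRange t).map fun j => P (u j).1 * R (u j).2)
    rw [List.map_map] at h3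
    exact h3.symm
  simp only [h1, pairPaths, Nat.cast_sum, Nat.cast_mul, Matrix.sum_apply, Finset.mul_sum,
    Finset.sum_mul]
  rw [Finset.sum_comm]
  refine Finset.sum_congr rfl fun a _ => ?_
  rw [Finset.sum_comm]
  refine Finset.sum_congr rfl fun b _ => Finset.sum_congr rfl fun u _ => ?_
  simp only [Matrix.smul_apply, Matrix.map_apply, smul_eq_mul]
  ring

omit [DecidableEq Q] in
-- For a fixed middle state `c`, the pairs with a path from `a` via `c` to `b` form a rectangle.
lemma weighted_entry (P R : (Fin m → Fin q) → Matrix Q Q ℕ) (hP : ∀ x a b, P x a b ≤ 1)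
    (hR : ∀ x a b, R x a b ≤ 1) (a b : Q) :
    (∑ i : (Fin m → Fin q) × (Fin m → Fin q), pairWeight i •
      ((P i.1 * R i.2).map (Nat.cast : ℕ → ℝ))) a b =
    ∑ c, ∑ x with P x a c = 1, ∑ y with R y c b = 1, pairWeight (x, y) := by
  have hind : ∀ n : ℕ, n ≤ 1 → (n : ℝ) = if n = 1 then 1 else 0 := by
    intro n hn; interval_cases n <;> simp
  rw [Matrix.sum_apply]
  simp only [Matrix.smul_apply, Matrix.map_apply, Matrix.mul_apply, Nat.cast_sum, Nat.cast_mul,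
    smul_eq_mul, Finset.mul_sum]
  rw [Finset.sum_comm]
  refine Finset.sum_congr rfl fun c _ => ?_
  rw [Fintype.sum_prod_type, Finset.sum_filter]
  refine Finset.sum_congr rfl fun x _ => ?_
  dsimp only
  rw [Finset.sum_filter, hind _ (hP x a c)]
  split_ifs with h
  · refine Finset.sum_congr rfl fun y _ => ?_
    rw [hind _ (hR y c b)]
    split_ifs <;> simp
  · simp

/-- If there is exactly one path on every sequence with a disjoint pair, then there is on average
almost one path on the sequences of intersecting pairs. -/
theorem sum_pairPaths_ge (hq : q = 16 * k) (hk : 0 < k) (hm : 8 * q ≤ m)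
    (P R : (Fin m → Fin q) → Matrix Q Q ℕ) (hP : ∀ x a b, P x a b ≤ 1)
    (hR : ∀ x a b, R x a b ≤ 1) (I F : Q → ℕ) (hI : ∀ a, I a ≤ 1) (hF : ∀ a, F a ≤ 1) (t : ℕ)
    (hone : ∀ u : Fin t → (Fin m → Fin q) × (Fin m → Fin q),
      (∃ j, ¬ Agree (u j).1 (u j).2) → pairPaths P R I F u = 1) :
    ((∑ i : (Fin m → Fin q) × (Fin m → Fin q), if Agree i.1 i.2 then (1 : ℝ) else 0)) ^ t
      - (∑ i : (Fin m → Fin q) × (Fin m → Fin q), pairWeight i) ^ t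
      - (Fintype.card Q : ℝ) ^ 2 * (t * (Fintype.card Q * (Fintype.card Q * (q : ℝ) ^ (2 * m))) ^ t
        * (1 / 2) ^ k) ≤
    ∑ u : Fin t → (Fin m → Fin q) × (Fin m → Fin q) with ∀ j, Agree (u j).1 (u j).2,
      (pairPaths P R I F u : ℝ) := by
  set Λ : Matrix Q Q ℝ := ∑ i : (Fin m → Fin q) × (Fin m → Fin q), pairWeight i •
      ((P i.1 * R i.2).map (Nat.cast : ℕ → ℝ)) with hΛ
  set V : ℝ := (q : ℝ) ^ (2 * m) with hV
  have hV0 : 0 ≤ V := by positivity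
  have hlow : ∀ a b, -(Fintype.card Q * V * (1 / 2) ^ k) ≤ Λ a b := by
    intro a b
    rw [hΛ, weighted_entry P R hP hR]
    calc -(Fintype.card Q * V * (1 / 2) ^ k) = ∑ _c : Q, -(V * (1 / 2) ^ k) := by
          rw [Finset.sum_const, Finset.card_univ, nsmul_eq_mul]; ring
      _ ≤ _ := Finset.sum_le_sum fun c _ => neg_le_rectangle_weight hq hk hm _ _
  have hup : ∀ a b, Λ a b ≤ Fintype.card Q * V := by
    intro a b
    rw [hΛ, weighted_entry P R hP hR]
    calc _ ≤ ∑ _c : Q, V := Finset.sum_le_sum fun c _ => rectangle_weight_le _ _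
      _ = _ := by rw [Finset.sum_const, Finset.card_univ, nsmul_eq_mul]
  have hentry := pow_entries_bound (M := Λ) (Γ := Fintype.card Q * V) (η := (1 / 2) ^ k)
    (by positivity) (by positivity) (pow_le_one₀ (by norm_num) (by norm_num)) hlow hup t
  set E : ℝ := t * (Fintype.card Q * (Fintype.card Q * V)) ^ t * (1 / 2) ^ k with hE
  have hE0 : 0 ≤ E := by positivity
  have hw := weighted_pairPaths P R I F t
  have hge : -((Fintype.card Q : ℝ) ^ 2 * E) ≤ ∑ a, ∑ b, (I a : ℝ) * (Λ ^ t) a b * F b := by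
    calc -((Fintype.card Q : ℝ) ^ 2 * E) = ∑ _a : Q, ∑ _b : Q, -E := by
          simp only [Finset.sum_const, Finset.card_univ, nsmul_eq_mul]; ring
      _ ≤ _ := by
          refine Finset.sum_le_sum fun a _ => Finset.sum_le_sum fun b _ => ?_
          have h1 : (I a : ℝ) ≤ 1 := by exact_mod_cast hI a
          have h2 : (F b : ℝ) ≤ 1 := by exact_mod_cast hF b
          have h3 : (0 : ℝ) ≤ (I a : ℝ) * F b := by positivity
          have h4 : (I a : ℝ) * F b ≤ 1 := mul_le_one₀ h1 (Nat.cast_nonneg _) h2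
          have h5 := (hentry a b).1
          nlinarith
  rw [← hw] at hge
  -- With a disjoint pair the number of paths is one and only the product of the weights remains.
  -- Without one, that product is `1`. So the total is a power of the sum of weights, corrected on
  -- the sequences of intersecting pairs.
  have hall : ∀ u : Fin t → (Fin m → Fin q) × (Fin m → Fin q),
      (∏ j, pairWeight (u j)) * (pairPaths P R I F u : ℝ) =
      (∏ j, pairWeight (u j)) + ((if ∀ j, Agree (u j).1 (u j).2 then (pairPaths P R I F u : ℝ) else 0)
        - ∏ j, if Agree (u j).1 (u j).2 then (1 : ℝ) else 0) := by
    intro u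
    by_cases h : ∀ j, Agree (u j).1 (u j).2
    · have h1 : ∏ j, pairWeight (u j) = 1 := Finset.prod_eq_one fun j _ => if_pos (h j)
      have h2 : ∏ j, (if Agree (u j).1 (u j).2 then (1 : ℝ) else 0) = 1 :=
        Finset.prod_eq_one fun j _ => if_pos (h j)
      rw [h1, h2, if_pos h]; ring
    · have h' := h
      push Not at h
      obtain ⟨j, hj⟩ := h
      have h2 : ∏ j, (if Agree (u j).1 (u j).2 then (1 : ℝ) else 0) = 0 :=
        Finset.prod_eq_zero (Finset.mem_univ j) (if_neg hj)
      rw [hone u ⟨j, hj⟩, h2, if_neg h']; simp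
  rw [Finset.sum_congr rfl fun u _ => hall u, Finset.sum_add_distrib, Finset.sum_sub_distrib,
    ← Fintype.sum_pow, ← Fintype.sum_pow (fun i : (Fin m → Fin q) × (Fin m → Fin q) =>
      if Agree i.1 i.2 then (1 : ℝ) else 0), ← Finset.sum_filter] at hge
  linarith

end Averaging

/-! ### Numerical estimates and the choice of a good block -/

section Selection

variable {m q k : ℕ}

variable (m q) in
/-- The number of pairs with intersecting graphs. -/
noncomputable def agreeCount : ℝ :=
  ∑ i : (Fin m → Fin q) × (Fin m → Fin q), if Agree i.1 i.2 then (1 : ℝ) else 0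

lemma sum_disagree :
    (∑ i : (Fin m → Fin q) × (Fin m → Fin q), if Agree i.1 i.2 then (0 : ℝ) else 1) =
      ((q : ℝ) * ((q - 1 : ℕ) : ℝ)) ^ m := by
  have h : ∀ x : Fin m → Fin q, (Finset.univ.filter fun y => ¬ Agree x y).card = (q - 1) ^ m := by
    intro x
    have hset : (Finset.univ.filter fun y : Fin m → Fin q => ¬ Agree x y) =
        Fintype.piFinset fun l => ({x l} : Finset (Fin q))ᶜ := by
      ext y
      simp only [Agree, Finset.mem_filter, Finset.mem_univ, true_and, not_exists,
        Fintype.mem_piFinset, Finset.mem_compl, Finset.mem_singleton]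
      exact forall_congr' fun l => not_congr eq_comm
    rw [hset, Fintype.card_piFinset]
    simp [Finset.card_compl]
  rw [Fintype.sum_prod_type]
  have h2 : ∀ x : Fin m → Fin q, (∑ y, if Agree x y then (0 : ℝ) else 1) = ((q - 1 : ℕ) : ℝ) ^ m := by
    intro x
    have := congrArg (Nat.cast : ℕ → ℝ) (h x)
    rw [Finset.card_filter] at this
    push_cast at this
    rw [← this]
    exact Finset.sum_congr rfl fun y _ => by split_ifs <;> simp_all
  simp only [h2, Finset.sum_const, Finset.card_univ, nsmul_eq_mul, mul_pow]
  simp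

lemma agreeCount_add : agreeCount m q + ((q : ℝ) * ((q - 1 : ℕ) : ℝ)) ^ m = (q : ℝ) ^ (2 * m) := by
  rw [← sum_disagree, agreeCount, ← Finset.sum_add_distrib]
  have : ∀ i : (Fin m → Fin q) × (Fin m → Fin q), ((if Agree i.1 i.2 then (1 : ℝ) else 0) +
      if Agree i.1 i.2 then (0 : ℝ) else 1) = 1 := fun i => by split_ifs <;> simp
  simp only [this]
  simp [two_mul, pow_add]

lemma sum_pairWeight : ∑ i : (Fin m → Fin q) × (Fin m → Fin q), pairWeight i =
    agreeCount m q - ((q : ℝ) * ((q - 1 : ℕ) : ℝ)) ^ m / 8 := by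
  rw [← sum_disagree, agreeCount, Finset.sum_div, ← Finset.sum_sub_distrib]
  refine Finset.sum_congr rfl fun i _ => ?_
  unfold pairWeight
  split_ifs <;> norm_num

lemma disagree_eq (hq : 0 < q) : ((q : ℝ) * ((q - 1 : ℕ) : ℝ)) ^ m =
    (q : ℝ) ^ (2 * m) * (1 - 1 / q) ^ m := by
  have : (q : ℝ) ≠ 0 := by positivity
  rw [pow_mul, ← mul_pow, Nat.cast_sub hq]
  congr 1
  field_simp
  simp

/-- The density of disjoint pairs is bounded away from `0` and `1` because `m` is between `8 * q`
and `16 * q`. For the lower bound, Bernoulli gives `1/2` at exponent `q / 2 = 8 * k`, and `32` such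
exponents reach `256 * k`. -/
lemma disagree_bounds (hq : q = 16 * k) (hk : 0 < k) (hm : 8 * q ≤ m) (hm' : m ≤ 256 * k) :
    (1 - 1 / (q : ℝ)) ^ m ≤ 1 / 2 ∧ (1 / 2 : ℝ) ^ 32 ≤ (1 - 1 / (q : ℝ)) ^ m := by
  have hq0 : (0 : ℝ) < q := by have : 0 < q := by omega
                               exact_mod_cast this
  have hq1 : 1 / (q : ℝ) ≤ 1 / 16 := by
    apply one_div_le_one_div_of_le (by norm_num)
    have : 16 ≤ q := by omega
    exact_mod_cast this
  have hqk : (q : ℝ) = 16 * k := by rw [hq]; push_cast; ring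
  have h0 : 0 ≤ 1 - 1 / (q : ℝ) := by linarith
  have h1 : 1 - 1 / (q : ℝ) ≤ 1 := by have : 0 < 1 / (q : ℝ) := by positivity
                                      linarith
  constructor
  · calc (1 - 1 / (q : ℝ)) ^ m ≤ (1 - 1 / (q : ℝ)) ^ q := pow_le_pow_of_le_one h0 h1 (by omega)
      _ ≤ (Real.exp (-(1 / (q : ℝ)))) ^ q := by
          gcongr
          exact Real.one_sub_le_exp_neg _
      _ = Real.exp (-1) := by
          rw [← Real.exp_nat_mul]; congr 1; field_simp
      _ ≤ 1 / 2 := by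
          rw [Real.exp_neg, one_div]
          apply inv_anti₀ (by norm_num)
          have := Real.add_one_le_exp (1 : ℝ)
          linarith
  · have hb : (1 / 2 : ℝ) ≤ (1 - 1 / (q : ℝ)) ^ (8 * k) := by
      have := one_add_mul_le_pow (a := -(1 / (q : ℝ))) (by linarith) (8 * k)
      rw [← sub_eq_add_neg] at this
      refine le_trans (le_of_eq ?_) this
      have hk' : (k : ℝ) ≠ 0 := by positivity
      rw [hqk]; push_cast; field_simp; norm_num
    calc (1 / 2 : ℝ) ^ 32 ≤ ((1 - 1 / (q : ℝ)) ^ (8 * k)) ^ 32 := by gcongr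
      _ = (1 - 1 / (q : ℝ)) ^ (256 * k) := by rw [← pow_mul]; congr 1; ring
      _ ≤ _ := pow_le_pow_of_le_one h0 h1 hm'

variable {Q : Type*} [Fintype Q] [DecidableEq Q]

/-- The loss `2 ^ (-35)` is the weight `1/8` times the least density `2 ^ (-32)` of disjoint pairs.
-/
lemma agreeCount_pos (hq : q = 16 * k) (hk : 0 < k) (hm : 8 * q ≤ m) (hm' : m ≤ 256 * k) :
    0 < agreeCount m q ∧ (q : ℝ) ^ (2 * m) ≤ 2 * agreeCount m q ∧
      0 ≤ ∑ i : (Fin m → Fin q) × (Fin m → Fin q), pairWeight i ∧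
      ∑ i : (Fin m → Fin q) × (Fin m → Fin q), pairWeight i ≤
        agreeCount m q * (1 - (1 / 2) ^ 35) := by
  have hV : 0 < (q : ℝ) ^ (2 * m) := by
    have : 0 < (q : ℝ) := by have : 0 < q := by omega
                             exact_mod_cast this
    positivity
  obtain ⟨h1, h2⟩ := disagree_bounds hq hk hm hm'
  have h3 := agreeCount_add (m := m) (q := q)
  rw [sum_pairWeight]
  rw [disagree_eq (by omega)] at h3 ⊢
  set V := (q : ℝ) ^ (2 * m)
  set b := (1 - 1 / (q : ℝ)) ^ m
  have h4 : V * b ≤ V * (1 / 2) := by gcongr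
  have h5 : V * (1 / 2) ^ 32 ≤ V * b := by gcongr
  have h6 : 0 ≤ V * b := le_trans (by positivity) h5
  refine ⟨by linarith, by linarith, by linarith, ?_⟩
  have h7 : agreeCount m q * (1 / 2) ^ 35 ≤ V * (1 / 2) ^ 35 := by
    gcongr; linarith
  norm_num at h5 h7 ⊢
  linarith

/-- If the numbers of paths on sequences with a disjoint pair are all one, for a small family of
choices of start and end states, then some sequence of intersecting pairs does not lose paths. -/
theorem exists_sequence_card_le (hq : q = 16 * k) (hk : 0 < k) (hm : 8 * q ≤ m) (hm' : m ≤ 256 * k)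
    (P R : (Fin m → Fin q) → Matrix Q Q ℕ) (hP : ∀ x a b, P x a b ≤ 1)
    (hR : ∀ x a b, R x a b ≤ 1) {ι : Type*} [Fintype ι] (I F : ι → Q → ℕ)
    (hι : Fintype.card ι ≤ Fintype.card Q)
    (hI : ∀ p a, I p a ≤ 1) (hF : ∀ p a, F p a ≤ 1) (t : ℕ)
    (hone : ∀ p, ∀ u : Fin t → (Fin m → Fin q) × (Fin m → Fin q),
      (∃ j, ¬ Agree (u j).1 (u j).2) → pairPaths P R (I p) (F p) u = 1)
    (hnum₁ : 4 * (Fintype.card Q : ℝ) * (1 - (1 / 2) ^ 35) ^ t ≤ 1)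
    (hnum₂ : 4 * (Fintype.card Q : ℝ) ^ (2 * t + 3) * t * 2 ^ t ≤ 2 ^ k) :
    ∃ u : Fin t → (Fin m → Fin q) × (Fin m → Fin q), (∀ j, Agree (u j).1 (u j).2) ∧
      Fintype.card ι ≤ ∑ p, pairPaths P R (I p) (F p) u := by
  obtain ⟨hE0, hVE, hw0, hwE⟩ := agreeCount_pos hq hk hm hm'
  set E := agreeCount m q with hE
  have hcard : ((Finset.univ.filter fun u : Fin t → (Fin m → Fin q) × (Fin m → Fin q) =>
      ∀ j, Agree (u j).1 (u j).2).card : ℝ) = E ^ t := by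
    rw [hE, agreeCount, Fintype.sum_pow, Finset.card_filter, Nat.cast_sum]
    refine Finset.sum_congr rfl fun u _ => ?_
    rw [Finset.prod_ite_zero]
    simp
  rcases isEmpty_or_nonempty ι with hemp | hne
  · have hpos : (0 : ℝ) < E ^ t := by positivity
    rw [← hcard, Nat.cast_pos, Finset.card_pos] at hpos
    obtain ⟨u, hu⟩ := hpos
    exact ⟨u, (Finset.mem_filter.1 hu).2, by simp⟩
  set S : ℝ := (Fintype.card Q : ℝ) with hS
  have hS1 : 1 ≤ S := by
    have : 0 < Fintype.card ι := Fintype.card_pos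
    have : 1 ≤ Fintype.card Q := by omega
    rw [hS]
    exact_mod_cast this
  have hEt : 0 < E ^ t := by positivity
  -- The mean deficit from one path is at most `1 / (2 * S)`: the power of the total weight
  -- contributes at most `1 / (4 * S)` by `hnum₁`, and the rectangle error as much by `hnum₂`.
  have hmean : ∀ p, S * (E ^ t - ∑ u : Fin t → (Fin m → Fin q) × (Fin m → Fin q) with
      ∀ j, Agree (u j).1 (u j).2, (pairPaths P R (I p) (F p) u : ℝ)) ≤ E ^ t / 2 := by
    intro p
    have h := sum_pairPaths_ge hq hk hm P R hP hR (I p) (F p) (hI p) (hF p) t (hone p)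
    change E ^ t - _ - _ ≤ _ at h
    have h1 : (∑ i : (Fin m → Fin q) × (Fin m → Fin q), pairWeight i) ^ t ≤
        E ^ t * (1 - (1 / 2) ^ 35) ^ t := by
      rw [← mul_pow]; gcongr
    have h2 : S ^ 2 * (t * (S * (S * (q : ℝ) ^ (2 * m))) ^ t * (1 / 2) ^ k) ≤
        S ^ 2 * (t * (S * (S * (2 * E))) ^ t * (1 / 2) ^ k) := by gcongr
    have h3 : S * (S ^ 2 * (t * (S * (S * (2 * E))) ^ t * (1 / 2) ^ k)) =
        E ^ t * (4 * S ^ (2 * t + 3) * t * 2 ^ t) * (1 / 2) ^ k / 4 := by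
      rw [show S * (S * (2 * E)) = S ^ 2 * 2 * E by ring, mul_pow, mul_pow, ← pow_mul,
        pow_add]
      ring
    have h4 : E ^ t * (4 * S ^ (2 * t + 3) * t * 2 ^ t) * (1 / 2) ^ k / 4 ≤ E ^ t / 4 := by
      have : E ^ t * (4 * S ^ (2 * t + 3) * t * 2 ^ t) * (1 / 2) ^ k ≤ E ^ t * 2 ^ k * (1 / 2) ^ k := by
        gcongr
      rw [mul_assoc (E ^ t) (2 ^ k), ← mul_pow, show (2 : ℝ) * (1 / 2) = 1 by norm_num, one_pow,
        mul_one] at this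
      linarith
    have h5 : S * (E ^ t * (1 - (1 / 2) ^ 35) ^ t) ≤ E ^ t / 4 := by
      have : E ^ t * (4 * S * (1 - (1 / 2) ^ 35) ^ t) ≤ E ^ t * 1 := by gcongr
      linarith
    have h6 := mul_le_mul_of_nonneg_left h (by linarith : 0 ≤ S)
    have h7 := mul_le_mul_of_nonneg_left h1 (by linarith : 0 ≤ S)
    have h8 := mul_le_mul_of_nonneg_left h2 (by linarith : 0 ≤ S)
    linarith
  -- The deficits of the at most `S` indices add up to at most `1/2` on average. By integrality a
  -- failing sequence has deficit at least one, so not all sequences fail.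
  by_contra! hcon
  have hup : ∀ u : Fin t → (Fin m → Fin q) × (Fin m → Fin q), (∀ j, Agree (u j).1 (u j).2) →
      (∑ p, (pairPaths P R (I p) (F p) u : ℝ)) ≤ Fintype.card ι - 1 := by
    intro u hu
    have := hcon u hu
    have h' : (∑ p, pairPaths P R (I p) (F p) u) + 1 ≤ Fintype.card ι := this
    have h'' : (∑ p, (pairPaths P R (I p) (F p) u : ℝ)) + 1 ≤ Fintype.card ι := by exact_mod_cast h'
    linarith
  have htot : ∑ p, ∑ u : Fin t → (Fin m → Fin q) × (Fin m → Fin q) with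
      ∀ j, Agree (u j).1 (u j).2, (pairPaths P R (I p) (F p) u : ℝ) ≤ E ^ t * (Fintype.card ι - 1) := by
    rw [Finset.sum_comm, ← hcard, ← nsmul_eq_mul, ← Finset.sum_const]
    exact Finset.sum_le_sum fun u hu => hup u (Finset.mem_filter.1 hu).2
  have hsum := Finset.sum_le_sum (s := (Finset.univ : Finset ι)) fun p _ => hmean p
  rw [← Finset.mul_sum, Finset.sum_sub_distrib, Finset.sum_const, Finset.sum_const,
    Finset.card_univ, nsmul_eq_mul, nsmul_eq_mul] at hsum
  have hιS : (Fintype.card ι : ℝ) ≤ S := by rw [hS]; exact_mod_cast hι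
  have h1 : S * E ^ t ≤ Fintype.card ι * (E ^ t / 2) := by
    refine le_trans ?_ hsum
    rw [mul_le_mul_iff_right₀ (by linarith)]
    linarith
  nlinarith

/-- The decay rate `x / 2 ^ 35` is eight times the growth rate `x / 2 ^ 38` allowed to `S`. The
surplus absorbs the factor `4` and the rounding of `t`. -/
lemma numeric_bound₁ {S x : ℝ} {t : ℕ} (hx : 2 ^ 38 ≤ x) (ht : x - 1 ≤ t)
    (hS : S ≤ 2 ^ (x / 2 ^ 38)) : 4 * S * (1 - (1 / 2) ^ 35) ^ t ≤ 1 := by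
  have he : (2 : ℝ) ≤ Real.exp 1 := by have := Real.add_one_le_exp (1 : ℝ); linarith
  have h1 : (2 : ℝ) ^ (x / 2 ^ 38) ≤ Real.exp (x / 2 ^ 38) := by
    calc (2 : ℝ) ^ (x / 2 ^ 38) ≤ (Real.exp 1) ^ (x / 2 ^ 38) := by
          apply Real.rpow_le_rpow (by norm_num) he (by positivity)
      _ = _ := by rw [Real.exp_one_rpow]
  have h2 : (4 : ℝ) ≤ Real.exp 2 := by
    rw [show (2 : ℝ) = 1 + 1 by norm_num, Real.exp_add]; nlinarith
  have h3 : (1 - (1 / 2 : ℝ) ^ 35) ^ t ≤ Real.exp (-(t * (1 / 2) ^ 35)) := by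
    calc (1 - (1 / 2 : ℝ) ^ 35) ^ t ≤ (Real.exp (-(1 / 2) ^ 35)) ^ t := by
          exact pow_le_pow_left₀ (by norm_num) (Real.one_sub_le_exp_neg _) t
      _ = _ := by rw [← Real.exp_nat_mul]; congr 1; ring
  calc 4 * S * (1 - (1 / 2) ^ 35) ^ t
      ≤ Real.exp 2 * Real.exp (x / 2 ^ 38) * Real.exp (-(t * (1 / 2) ^ 35)) := by
        have h5 : 4 * S ≤ Real.exp 2 * Real.exp (x / 2 ^ 38) :=
          mul_le_mul_of_nonneg h2 (hS.trans h1) (by norm_num) (Real.exp_pos _).le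
        exact mul_le_mul h5 h3 (pow_nonneg (by norm_num) t) (by positivity)
    _ = Real.exp (2 + x / 2 ^ 38 + -(t * (1 / 2) ^ 35)) := by rw [Real.exp_add, Real.exp_add]
    _ ≤ 1 := by
        rw [Real.exp_le_one_iff]
        norm_num at hx ⊢
        linarith

/-- The exponent on the left is at most quadratic in `x`, whereas `k` is about `x ^ 3 / 128`. -/
lemma numeric_bound₂ {S x : ℝ} {t k : ℕ} (hx : 2 ^ 38 ≤ x) (ht : (t : ℝ) ≤ x) (hS0 : 0 ≤ S)
    (hS : S ≤ 2 ^ (x / 2 ^ 38)) (hk : x ^ 3 ≤ 128 * k + 128) :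
    4 * S ^ (2 * t + 3) * t * 2 ^ t ≤ 2 ^ k := by
  have ht2 : (t : ℝ) ≤ 2 ^ (t : ℝ) := by
    rw [Real.rpow_natCast]; exact_mod_cast Nat.lt_two_pow_self.le
  calc 4 * S ^ (2 * t + 3) * t * 2 ^ t
      ≤ 2 ^ (2 : ℝ) * (2 ^ (x / 2 ^ 38)) ^ (2 * t + 3) * 2 ^ (t : ℝ) * 2 ^ (t : ℝ) := by
        have h4 : (2 : ℝ) ^ (2 : ℝ) = 4 := by norm_num
        rw [h4, ← Real.rpow_natCast 2 t]
        gcongr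
    _ = 2 ^ (2 + x / 2 ^ 38 * (2 * t + 3) + t + t) := by
        rw [← Real.rpow_mul_natCast (by norm_num), Real.rpow_add (by norm_num),
          Real.rpow_add (by norm_num), Real.rpow_add (by norm_num)]
        push_cast
        ring_nf
    _ ≤ 2 ^ (k : ℝ) := by
        apply Real.rpow_le_rpow_of_exponent_le (by norm_num)
        have hx0 : 0 < x := by linarith [show (0 : ℝ) < 2 ^ 38 by norm_num]
        have h1 : x / 2 ^ 38 * (2 * t + 3) ≤ x / 2 ^ 38 * (2 * x + 3) := by gcongr
        have h2 : x / 2 ^ 38 ≤ x := div_le_self hx0.le (by norm_num)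
        have h3 : x / 2 ^ 38 * (2 * x + 3) ≤ x * (2 * x + 3) := by gcongr
        have h4 : 2 ^ 38 * x ^ 2 ≤ x ^ 3 := by
          rw [pow_succ x 2, mul_comm]; gcongr
        have h5 : 2 ^ 38 * x ≤ x ^ 2 := by rw [sq]; gcongr
        norm_num at hx h4 h5
        nlinarith
    _ = 2 ^ k := Real.rpow_natCast _ _

end Selection

/-! ### Path counts of automata, ambiguity and trimming -/

section PathCount

variable {α σ : Type} [Fintype σ] [DecidableEq σ]

open Classical in
/-- The number of paths of an NFA between two states, as a matrix depending on the word. -/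
noncomputable def pathCount (M : NFA α σ) : FreeMonoid α →* Matrix σ σ ℕ :=
  FreeMonoid.lift fun a => Matrix.of fun p q => if q ∈ M.step p a then 1 else 0

open Classical in
lemma pathCount_of (M : NFA α σ) (a : α) (p q : σ) :
    pathCount M (FreeMonoid.of a) p q = if q ∈ M.step p a then 1 else 0 := by
  simp [pathCount]

lemma pathCount_of_le_one (M : NFA α σ) (a : α) (p q : σ) :
    pathCount M (FreeMonoid.of a) p q ≤ 1 := by
  rw [pathCount_of]; split_ifs <;> simp

lemma leads_of {M : NFA α σ} {a : α} {p q : σ} :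
    Leads (pathCount M) (FreeMonoid.of a) p q ↔ q ∈ M.step p a := by
  unfold Leads
  rw [pathCount_of]; split_ifs with h <;> simp [h]

lemma mem_evalFrom_iff_leads (M : NFA α σ) (w : List α) (S : Set σ) (q : σ) :
    q ∈ M.evalFrom S w ↔ ∃ p ∈ S, Leads (pathCount M) (FreeMonoid.ofList w) p q := by
  induction w generalizing S with
  | nil =>
    rw [NFA.evalFrom_nil, FreeMonoid.ofList_nil]
    constructor
    · exact fun h => ⟨q, h, leads_one q⟩
    · rintro ⟨p, hp, h⟩
      have : p = q := by
        by_contra hne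
        simp [Leads, Matrix.one_apply_ne hne] at h
      exact this ▸ hp
  | cons a w ih =>
    rw [NFA.evalFrom_cons, ih, FreeMonoid.ofList_cons]
    simp only [leads_mul, NFA.mem_stepSet, leads_of]
    constructor
    · rintro ⟨p', ⟨p, hp, h1⟩, h2⟩
      exact ⟨p, hp, p', h1, h2⟩
    · rintro ⟨p, hp, p', h1, h2⟩
      exact ⟨p', ⟨p, hp, h1⟩, h2⟩

lemma mem_accepts_iff_leads (M : NFA α σ) (w : List α) : w ∈ M.accepts ↔
    ∃ p ∈ M.start, ∃ q ∈ M.accept, Leads (pathCount M) (FreeMonoid.ofList w) p q := by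
  rw [NFA.mem_accepts]
  simp only [mem_evalFrom_iff_leads]
  constructor
  · rintro ⟨q, hq, p, hp, h⟩; exact ⟨p, hp, q, hq, h⟩
  · rintro ⟨p, hp, q, hq, h⟩; exact ⟨q, hq, p, hp, h⟩

open Classical in
/-- The computations on `w` from the state `p` to an accepting state. -/
noncomputable def runsFrom (M : NFA α σ) (w : List α) (p : σ) : Finset (Fin (w.length + 1) → σ) :=
  {c | c 0 = p ∧ (∀ i : Fin w.length, c i.succ ∈ M.step (c i.castSucc) (w.get i)) ∧
    c (Fin.last w.length) ∈ M.accept}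

open Classical in
lemma card_runsFrom_nil (M : NFA α σ) (p : σ) :
    (runsFrom M [] p).card = if p ∈ M.accept then 1 else 0 := by
  have : runsFrom M [] p = if p ∈ M.accept then {fun _ => p} else ∅ := by
    ext c
    have hc : c = (fun _ => p) ↔ c 0 = p :=
      ⟨fun h => by rw [h], fun h => funext fun i => by rw [← h]; congr 1; exact (Subsingleton.elim (α := Fin 1) _ _)⟩
    have hl : (Fin.last ([] : List α).length) = 0 := rfl
    simp only [runsFrom, Finset.mem_filter, Finset.mem_univ, true_and, hl]
    split_ifs with h
    · rw [Finset.mem_singleton, hc]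
      exact ⟨fun h' => h'.1, fun h' => ⟨h', fun i => i.elim0, h' ▸ h⟩⟩
    · simp only [Finset.notMem_empty, iff_false]
      rintro ⟨h1, -, h3⟩
      exact h (h1 ▸ h3)
  rw [this]; split_ifs <;> simp

open Classical in
lemma card_runsFrom_cons (M : NFA α σ) (a : α) (w : List α) (p : σ) :
    (runsFrom M (a :: w) p).card = ∑ p' with p' ∈ M.step p a, (runsFrom M w p').card := by
  have h : runsFrom M (a :: w) p = (Finset.univ.filter fun p' => p' ∈ M.step p a).biUnion
      fun p' => (runsFrom M w p').image (fun c => (Fin.cons p c : Fin (w.length + 1 + 1) → σ)) := by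
    ext c
    simp only [runsFrom, Finset.mem_filter, Finset.mem_univ, true_and, Finset.mem_biUnion,
      Finset.mem_image]
    constructor
    · rintro ⟨h0, hs, hl⟩
      refine ⟨c 1, ?_, Fin.tail c, ⟨rfl, fun i => hs i.succ, hl⟩, ?_⟩
      · rw [← h0]; exact hs 0
      · rw [← h0]; exact Fin.cons_self_tail c
    · rintro ⟨p', hp', d, ⟨hd0, hds, hdl⟩, rfl⟩
      refine ⟨rfl, fun i => ?_, hdl⟩
      refine Fin.cases ?_ (fun j => ?_) i
      · change d 0 ∈ M.step p a
        rw [hd0]; exact hp'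
      · exact hds j
  rw [h, Finset.card_biUnion]
  · refine Finset.sum_congr rfl fun p' _ => ?_
    exact Finset.card_image_of_injective _ (Fin.cons_right_injective (α := fun _ => σ) p)
  · intro p₁ _ p₂ _ hne
    rw [Function.onFun, Finset.disjoint_left]
    intro c h1 h2
    obtain ⟨d, hd, rfl⟩ := Finset.mem_image.1 h1
    obtain ⟨d', hd', heq⟩ := Finset.mem_image.1 h2
    have : d' = d := Fin.cons_right_injective (α := fun _ => σ) p heq
    simp only [runsFrom, Finset.mem_filter] at hd hd'
    exact hne (hd.2.1.symm.trans ((congrFun this.symm 0).trans hd'.2.1))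

open Classical in
lemma card_runsFrom (M : NFA α σ) (w : List α) (p : σ) :
    (runsFrom M w p).card = ∑ q with q ∈ M.accept, pathCount M (FreeMonoid.ofList w) p q := by
  induction w generalizing p with
  | nil =>
    rw [card_runsFrom_nil, FreeMonoid.ofList_nil, map_one]
    simp only [Matrix.one_apply, Finset.sum_ite_eq, Finset.mem_filter, Finset.mem_univ, true_and]
  | cons a w ih =>
    rw [card_runsFrom_cons, FreeMonoid.ofList_cons, map_mul]
    simp only [Matrix.mul_apply, pathCount_of, ih, ite_mul, one_mul, zero_mul]
    rw [Finset.sum_filter, eq_comm, Finset.sum_comm]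
    exact Finset.sum_congr rfl fun m _ => by split_ifs <;> simp

open Classical in
lemma wordAmbiguity_eq (M : NFA α σ) (w : List α) :
    wordAmbiguity M w = ∑ p with p ∈ M.start, (runsFrom M w p).card := by
  have h : acceptingComputations M w = ↑((Finset.univ.filter fun p => p ∈ M.start).biUnion
      fun p => runsFrom M w p) := by
    ext c
    simp [acceptingComputations, runsFrom, and_left_comm]
  rw [wordAmbiguity, h, Set.ncard_coe_finset, Finset.card_biUnion]
  intro p₁ _ p₂ _ hne
  rw [Function.onFun, Finset.disjoint_left]
  intro c h1 h2
  simp only [runsFrom, Finset.mem_filter] at h1 h2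
  exact hne (h1.2.1.symm.trans h2.2.1)

lemma pathCount_le_wordAmbiguity (M : NFA α σ) (w : List α) {p q : σ} (hp : p ∈ M.start)
    (hq : q ∈ M.accept) : pathCount M (FreeMonoid.ofList w) p q ≤ wordAmbiguity M w := by
  classical
  rw [wordAmbiguity_eq]
  refine le_trans ?_ (Finset.single_le_sum (f := fun p => (runsFrom M w p).card)
    (fun _ _ => Nat.zero_le _) (by simpa using hp : p ∈ Finset.univ.filter fun p => p ∈ M.start))
  rw [card_runsFrom]
  exact Finset.single_le_sum (f := fun q => pathCount M (FreeMonoid.ofList w) p q)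
    (fun _ _ => Nat.zero_le _) (by simpa using hq)

omit [Fintype σ] [DecidableEq σ] in
lemma wordAmbiguity_le_ambiguity [Fintype α] (M : NFA α σ) (w : List α) :
    wordAmbiguity M w ≤ ambiguity M w.length := by
  let v : List.Vector α w.length := ⟨w, rfl⟩
  exact Finset.le_sup (f := fun v : List.Vector α w.length => wordAmbiguity M v.toList)
    (Finset.mem_univ v)

lemma pathCount_le_ambiguity [Fintype α] (M : NFA α σ) (w : FreeMonoid α) {p q : σ}
    (hp : p ∈ M.start) (hq : q ∈ M.accept) : pathCount M w p q ≤ ambiguity M w.length :=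
  (pathCount_le_wordAmbiguity M w.toList hp hq).trans (wordAmbiguity_le_ambiguity M w.toList)

/-- The number of paths on words of linear length cannot grow like `n ^ k` if the ambiguity is
`o(n ^ k)`. -/
lemma not_choose_le_pathCount [Fintype α] {M : NFA α σ} {k : ℕ}
    (h : (fun n : ℕ => (ambiguity M n : ℝ)) =o[atTop] fun n : ℕ => (n : ℝ) ^ k) (c₁ c₂ C : ℕ)
    (hw : ∀ n, ∃ w : FreeMonoid α, n ≤ w.length ∧ w.length ≤ c₁ + n * c₂ ∧
      ∃ p ∈ M.start, ∃ q ∈ M.accept, n.choose k ≤ C * pathCount M w p q) : False := by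
  set B : ℝ := 2 ^ k * k.factorial * C * (c₁ + c₂) ^ k with hB
  have hB0 : 0 ≤ B := by positivity
  have hev := h.def (c := 1 / (B + 1)) (by positivity)
  obtain ⟨n₀, hn₀⟩ := eventually_atTop.1 hev
  -- For `n` beyond `2 * k`, `n ≤ 2 * (n + 1 - k)`, whence `n ^ k ≤ 2 ^ k * k ! * n.choose k`.
  set n := max n₀ (2 * k + 1) with hn
  have hn1 : n₀ ≤ n := le_max_left _ _
  have hn2 : 2 * k + 1 ≤ n := le_max_right _ _
  obtain ⟨w, hw1, hw2, p, hp, q, hq, hch⟩ := hw n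
  have ha := hn₀ w.length (hn1.trans hw1)
  rw [Real.norm_of_nonneg (Nat.cast_nonneg _), Real.norm_of_nonneg (by positivity)] at ha
  have hlen : (w.length : ℝ) ≤ (c₁ + c₂) * n := by
    have : w.length ≤ (c₁ + c₂) * n := by
      refine hw2.trans ?_
      have : c₁ ≤ c₁ * n := Nat.le_mul_of_pos_right _ (by omega)
      nlinarith
    exact_mod_cast this
  have hpow : (n : ℝ) ^ k ≤ 2 ^ k * k.factorial * n.choose k := by
    have h1 : n ^ k ≤ 2 ^ k * (k.factorial * n.choose k) := by
      rw [← Nat.descFactorial_eq_factorial_mul_choose]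
      calc n ^ k ≤ (2 * (n + 1 - k)) ^ k := Nat.pow_le_pow_left (by omega) k
        _ = 2 ^ k * (n + 1 - k) ^ k := mul_pow ..
        _ ≤ _ := Nat.mul_le_mul_left _ (Nat.pow_sub_le_descFactorial n k)
    rw [mul_assoc]
    exact_mod_cast h1
  have hnk : (0 : ℝ) < (n : ℝ) ^ k := by
    have : 0 < n := by omega
    positivity
  have hfin : (n : ℝ) ^ k ≤ B / (B + 1) * (n : ℝ) ^ k := by
    have h1 : (n.choose k : ℝ) ≤ C * ambiguity M w.length := by
      have := hch.trans (Nat.mul_le_mul_left C (pathCount_le_ambiguity M w hp hq))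
      exact_mod_cast this
    calc (n : ℝ) ^ k ≤ 2 ^ k * k.factorial * n.choose k := hpow
      _ ≤ 2 ^ k * k.factorial * (C * (1 / (B + 1) * ((c₁ + c₂) * n) ^ k)) := by
          have h2 : (ambiguity M w.length : ℝ) ≤ 1 / (B + 1) * ((c₁ + c₂) * n) ^ k :=
            ha.trans (by gcongr)
          have h3 := h1.trans (mul_le_mul_of_nonneg_left h2 (Nat.cast_nonneg C))
          gcongr
      _ = _ := by rw [mul_pow, hB]; ring
  have : B / (B + 1) < 1 := by rw [div_lt_one (by linarith)]; linarith
  nlinarith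

/-- The state `p` lies on an accepting computation. -/
def Useful (M : NFA α σ) (p : σ) : Prop :=
  (∃ w, ∃ s ∈ M.start, Leads (pathCount M) w s p) ∧
    ∃ w, ∃ f ∈ M.accept, Leads (pathCount M) w p f

/-- The NFA `M` without the transitions between useless states. -/
def trim (M : NFA α σ) : NFA α σ where
  step p a := {q | q ∈ M.step p a ∧ Useful M p ∧ Useful M q}
  start := M.start
  accept := M.accept

lemma pathCount_trim_le (M : NFA α σ) (w : FreeMonoid α) (p q : σ) :
    pathCount (trim M) w p q ≤ pathCount M w p q := by
  induction w using FreeMonoid.inductionOn' generalizing p with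
  | one => simp
  | of_mul a w ih =>
    rw [map_mul, map_mul, Matrix.mul_apply, Matrix.mul_apply]
    refine Finset.sum_le_sum fun m _ => Nat.mul_le_mul ?_ (ih m)
    rw [pathCount_of, pathCount_of]
    split_ifs with h1 h2
    · rfl
    · exact absurd h1.1 h2
    · exact Nat.zero_le _
    · rfl

lemma leads_trim {M : NFA α σ} {w : FreeMonoid α} {p q : σ} (h : Leads (pathCount M) w p q)
    (hp : ∃ w, ∃ s ∈ M.start, Leads (pathCount M) w s p)
    (hq : ∃ w, ∃ f ∈ M.accept, Leads (pathCount M) w q f) : Leads (pathCount (trim M)) w p q := by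
  induction w using FreeMonoid.inductionOn' generalizing p with
  | one => simpa [Leads] using h
  | of_mul a w ih =>
    have h0 := h
    obtain ⟨m, h1, h2⟩ := leads_mul.1 h
    obtain ⟨v, s, hs, hv⟩ := hp
    obtain ⟨v', f, hf, hv'⟩ := hq
    have hm : ∃ w, ∃ s ∈ M.start, Leads (pathCount M) w s m := ⟨_, s, hs, hv.mul h1⟩
    refine leads_mul.2 ⟨m, leads_of.2 ⟨leads_of.1 h1, ⟨⟨v, s, hs, hv⟩, ?_⟩, hm, ?_⟩, ih h2 hm⟩
    · exact ⟨_, f, hf, h0.mul hv'⟩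
    · exact ⟨_, f, hf, h2.mul hv'⟩

lemma useful_of_leads_trim {M : NFA α σ} {w : FreeMonoid α} (hw : w ≠ 1) {p q : σ}
    (h : Leads (pathCount (trim M)) w p q) : Useful M p := by
  induction w using FreeMonoid.casesOn with
  | one => exact absurd rfl hw
  | of_mul a w =>
    obtain ⟨m, h1, -⟩ := leads_mul.1 h
    exact (leads_of.1 h1).2.1

/-- Two loops at `p` on `w` give `2 ^ n ≥ n.choose k` paths on `w ^ n`. Trimming ensures that `p` is
useful, so these paths extend to accepting computations on words of linear length. -/
lemma loopUnambiguous_trim [Fintype α] {M : NFA α σ} {k : ℕ}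
    (h : (fun n : ℕ => (ambiguity M n : ℝ)) =o[atTop] fun n : ℕ => (n : ℝ) ^ k) :
    LoopUnambiguous (pathCount (trim M)) := by
  intro w p
  by_contra hlt
  have hw : w ≠ 1 := by rintro rfl; simp at hlt
  have hlead : Leads (pathCount (trim M)) w p p := by unfold Leads; omega
  obtain ⟨⟨a, s, hs, ha⟩, b, f, hf, hb⟩ := useful_of_leads_trim hw hlead
  have h2 : 2 ≤ pathCount M w p p := by
    have := pathCount_trim_le M w p p
    omega
  have hpow : ∀ n, 2 ^ n ≤ pathCount M (w ^ n) p p := by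
    intro n
    induction n with
    | zero => simp
    | succ n ih =>
      rw [pow_succ, pow_succ]
      exact (Nat.mul_le_mul ih h2).trans (mul_apply_le _ _ _ _ _ _)
  have hlpow : ∀ n, (w ^ n).length = n * w.length := by
    intro n
    induction n with
    | zero => simp
    | succ n ih => rw [pow_succ, FreeMonoid.length_mul, ih]; ring
  have hwl : 1 ≤ w.length := by
    rw [Nat.one_le_iff_ne_zero]
    exact fun h0 => hw (FreeMonoid.length_eq_zero.1 h0)
  refine not_choose_le_pathCount h (a.length + b.length) w.length 1 fun n =>
    ⟨a * w ^ n * b, ?_, ?_, s, hs, f, hf, ?_⟩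
  · rw [FreeMonoid.length_mul, FreeMonoid.length_mul, hlpow]; nlinarith
  · rw [FreeMonoid.length_mul, FreeMonoid.length_mul, hlpow]; linarith
  · rw [one_mul]
    refine (Nat.choose_le_two_pow n k).trans ((hpow n).trans ?_)
    have h3 := mul_apply_le (pathCount M) a (w ^ n) s p p
    have h4 := mul_apply_le (pathCount M) (a * w ^ n) b s p f
    unfold Leads at ha hb
    exact (Nat.le_mul_of_pos_left _ ha).trans (h3.trans ((Nat.le_mul_of_pos_right _ hb).trans h4))

end PathCount

/-! ### Blocks and the contradiction with small ambiguity -/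

section Blocks

variable {α : Type}

lemma flatten_inj_of_length {ℓ : ℕ} (hℓ : 0 < ℓ) {ws ws' : List (List α)}
    (h : ∀ u ∈ ws, u.length = ℓ) (h' : ∀ u ∈ ws', u.length = ℓ) (heq : ws.flatten = ws'.flatten) :
    ws = ws' := by
  induction ws generalizing ws' with
  | nil =>
    cases ws' with
    | nil => rfl
    | cons u' ws' =>
      have h1 := congrArg List.length heq
      have h2 := h' u' (by simp)
      rw [List.flatten_cons, List.length_append, List.flatten_nil, List.length_nil] at h1
      omega
  | cons u ws ih =>
    cases ws' with
    | nil =>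
      have h1 := congrArg List.length heq
      have h2 := h u (by simp)
      rw [List.flatten_cons, List.length_append, List.flatten_nil, List.length_nil] at h1
      omega
    | cons u' ws' =>
      rw [List.flatten_cons, List.flatten_cons] at heq
      obtain ⟨h1, h2⟩ := List.append_inj heq ((h u (by simp)).trans (h' u' (by simp)).symm)
      rw [h1, ih (fun v hv => h v (List.mem_cons_of_mem _ hv))
        (fun v hv => h' v (List.mem_cons_of_mem _ hv)) h2]

open Classical in
/-- The word `w` consists of blocks of length `ℓ`, exactly `n` of which belong to `L`. -/
def BlockCount (ℓ : ℕ) (L : Language α) (w : FreeMonoid α) (n : ℕ) : Prop :=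
  ∃ ws : List (List α), (∀ u ∈ ws, u.length = ℓ) ∧ w.toList = ws.flatten ∧
    ws.countP (fun u => decide (u ∈ L)) = n

variable {ℓ : ℕ} {L : Language α}

lemma BlockCount.one : BlockCount ℓ L 1 0 := ⟨[], by simp⟩

lemma BlockCount.mul {w w' : FreeMonoid α} {n n' : ℕ} (h : BlockCount ℓ L w n)
    (h' : BlockCount ℓ L w' n') : BlockCount ℓ L (w * w') (n + n') := by
  obtain ⟨ws, h1, h2, h3⟩ := h
  obtain ⟨ws', h1', h2', h3'⟩ := h'
  refine ⟨ws ++ ws', ?_, ?_, ?_⟩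
  · intro u hu
    rcases List.mem_append.1 hu with hu | hu
    · exact h1 u hu
    · exact h1' u hu
  · rw [FreeMonoid.toList_mul, h2, h2', List.flatten_append]
  · rw [List.countP_append, h3, h3']

lemma BlockCount.pow {w : FreeMonoid α} {n : ℕ} (h : BlockCount ℓ L w n) (m : ℕ) :
    BlockCount ℓ L (w ^ m) (m * n) := by
  induction m with
  | zero => simpa using BlockCount.one
  | succ m ih => rw [pow_succ, Nat.succ_mul]; exact ih.mul h

lemma BlockCount.of_mem {w : List α} (hw : w.length = ℓ) (h : w ∈ L) :
    BlockCount ℓ L (FreeMonoid.ofList w) 1 := ⟨[w], by simp [hw], by simp, by simp [h]⟩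

lemma BlockCount.of_notMem {w : List α} (hw : w.length = ℓ) (h : w ∉ L) :
    BlockCount ℓ L (FreeMonoid.ofList w) 0 := ⟨[w], by simp [hw], by simp, by simp [h]⟩

lemma BlockCount.mem_atLeast_iff (hℓ : 0 < ℓ) {w : FreeMonoid α} {n k : ℕ}
    (h : BlockCount ℓ L w n) : w.toList ∈ atLeast ℓ k L ↔ k ≤ n := by
  obtain ⟨ws, h1, h2, rfl⟩ := h
  constructor
  · rintro ⟨ws', h1', h2', h3'⟩
    rwa [flatten_inj_of_length hℓ h1 h1' (h2.symm.trans h2')]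
  · exact fun hk => ⟨ws, h1, h2, hk⟩

variable (ℓ L) in
/-- The words all of whose blocks lie outside `L`. -/
def negativeWords : Submonoid (FreeMonoid α) where
  carrier := {w | BlockCount ℓ L w 0}
  one_mem' := BlockCount.one
  mul_mem' h h' := h.mul h'

section Chain

variable {W Q : Type*} [Monoid W] [Fintype Q] [DecidableEq Q] {φ : W →* Matrix Q Q ℕ}

/-- Every path on the idempotent `e` can be rerouted through a fixed state. Doing so in each of the
`k + 1` occurrences of `e` gives the chain. -/
lemma exists_chain {e u : W} (he : RelIdempotent φ e) {s : Q} (k : ℕ) {f : Q}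
    (h : Leads φ (e * (u * e) ^ k) s f) :
    ∃ p : ℕ → Q, (∀ i ≤ k, Leads φ e (p i) (p i)) ∧ Leads φ e s (p 0) ∧ Leads φ e (p k) f ∧
      ∀ i < k, Leads φ (e * u * e) (p i) (p (i + 1)) := by
  induction k generalizing f with
  | zero =>
    rw [pow_zero, mul_one] at h
    obtain ⟨m, h1, h2, h3⟩ := he.exists_fixed h
    exact ⟨fun _ => m, fun _ _ => h1, h2, h3, by simp⟩
  | succ k ih =>
    rw [pow_succ, ← mul_assoc, leads_mul] at h
    obtain ⟨y, h1, h2⟩ := h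
    obtain ⟨z, h3, h4⟩ := leads_mul.1 h2
    obtain ⟨g, h5, h6, h7⟩ := he.exists_fixed h4
    obtain ⟨p, hp, hs, hy, hstep⟩ := ih h1
    refine ⟨Function.update p (k + 1) g, ?_, ?_, ?_, ?_⟩
    · intro i hi
      rcases hi.eq_or_lt with rfl | hlt
      · simpa using h5
      · rw [Function.update_of_ne hlt.ne]; exact hp i (by omega)
    · rw [Function.update_of_ne (by omega)]; exact hs
    · simpa using h7
    · intro i hi
      rw [Function.update_of_ne hi.ne]
      rcases (Nat.lt_succ_iff.1 hi).eq_or_lt with rfl | hlt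
      · rw [Function.update_self]
        exact (hy.mul h3).mul h6
      · rw [Function.update_of_ne (by omega)]
        exact hstep i hlt

lemma leads_pow_of_chain {v : W} {p : ℕ → Q} {k : ℕ}
    (hstep : ∀ i < k, Leads φ v (p i) (p (i + 1))) (i n : ℕ) (h : i + n ≤ k) :
    Leads φ (v ^ n) (p i) (p (i + n)) := by
  induction n with
  | zero => simpa using leads_one (φ := φ) (p i)
  | succ n ih =>
    rw [pow_succ]
    exact (ih (by omega)).mul (hstep (i + n) (by omega))

end Chain

variable {σ : Type} [Fintype σ] [DecidableEq σ]

/-- A block of `L` that does not lose any returning paths contradicts small ambiguity. -/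
theorem false_of_card_le_returns [Fintype α] (hℓ : 0 < ℓ) {M : NFA α σ} {k : ℕ}
    (hacc : M.accepts = atLeast ℓ k L)
    (ho : (fun n : ℕ => (ambiguity M n : ℝ)) =o[atTop] fun n : ℕ => (n : ℝ) ^ k)
    {e : FreeMonoid α} (he : IsMinIdempotent (pathCount (trim M)) (negativeWords ℓ L) e)
    {u : FreeMonoid α} (hu : BlockCount ℓ L u 1)
    (hret : Fintype.card {p // Leads (pathCount (trim M)) e p p} ≤
      ∑ p : {p // Leads (pathCount (trim M)) e p p}, he.returns u p.1) : False := by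
  have hφ := loopUnambiguous_trim ho
  set φ := pathCount (trim M) with hφdef
  have he0 : BlockCount ℓ L e 0 := he.mem
  have hmem : ∀ {w : FreeMonoid α} {n : ℕ}, BlockCount ℓ L w n →
      ((∃ s ∈ M.start, ∃ f ∈ M.accept, Leads φ w s f) ↔ k ≤ n) := by
    intro w n hw
    rw [← hw.mem_atLeast_iff hℓ, ← hacc, mem_accepts_iff_leads, FreeMonoid.ofList_toList]
    constructor
    · rintro ⟨s, hs, f, hf, h⟩
      exact ⟨s, hs, f, hf, lt_of_lt_of_le h (pathCount_trim_le M w s f)⟩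
    · rintro ⟨s, hs, f, hf, h⟩
      exact ⟨s, hs, f, hf, leads_trim h ⟨1, s, hs, leads_one s⟩ ⟨1, f, hf, leads_one f⟩⟩
  have hword : BlockCount ℓ L (e * (u * e) ^ k) k := by
    have := he0.mul ((hu.mul he0).pow k)
    simpa using this
  obtain ⟨s, hs, f, hf, hsf⟩ := (hmem hword).2 le_rfl
  obtain ⟨p, hp, hsp, hpf, hstep⟩ := exists_chain he.idem k hsf
  -- A negative word `v` from `p i` to `p j` would replace `j - i` of the positive blocks, so a word
  -- with only `k - (j - i)` positive blocks would be accepted.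
  have hns : ∀ i j, i < j → j ≤ k → ¬ Sim φ (negativeWords ℓ L) (p i) (p j) := by
    rintro i j hij hjk ⟨⟨v, hv, hvl⟩, -⟩
    have h1 := leads_pow_of_chain hstep 0 i (by omega)
    have h2 := leads_pow_of_chain hstep j (k - j) (by omega)
    rw [zero_add] at h1
    rw [show j + (k - j) = k by omega] at h2
    have h3 := (((hsp.mul h1).mul hvl).mul h2).mul hpf
    have hv0 : BlockCount ℓ L v 0 := hv
    have heue : BlockCount ℓ L (e * u * e) 1 := by
      have := (he0.mul hu).mul he0
      simpa using this
    have hcount := (((he0.mul (heue.pow i)).mul hv0).mul (heue.pow (k - j))).mul he0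
    have := (hmem hcount).1 ⟨s, hs, f, hf, h3⟩
    omega
  have hulen : 1 ≤ u.length := by
    obtain ⟨ws, h1, h2, h3⟩ := hu
    cases ws with
    | nil => simp at h3
    | cons v ws =>
      have := congrArg List.length h2
      rw [List.flatten_cons, List.length_append, h1 v (by simp)] at this
      change u.length = _ at this
      omega
  obtain ⟨c, C, hgrow⟩ := he.exists_choose_le_paths hφ hret hp hstep hns FreeMonoid.length
    (fun v w => FreeMonoid.length_mul v w)
  -- Paths may end anywhere in the class of `p k`. Each such state leads back to `p k` and on to
  -- `f`, by a suffix whose length is bounded independently of `n`.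
  have hsuf : ∀ q, ∃ b, Sim φ (negativeWords ℓ L) (p k) q → Leads φ b q f := by
    intro q
    by_cases hq : Sim φ (negativeWords ℓ L) (p k) q
    · obtain ⟨w, -, hw⟩ := hq.2
      exact ⟨w * e, fun _ => hw.mul hpf⟩
    · exact ⟨1, fun h => absurd h hq⟩
  choose b hb using hsuf
  set B := Finset.univ.sup fun q => (b q).length
  -- The factor `Fintype.card σ` is pigeonhole: one end state receives at least that fraction of the
  -- paths.
  refine not_choose_le_pathCount ho (e.length + B) c (C * Fintype.card σ) fun n => ?_
  obtain ⟨z, hz1, hz2, hz3⟩ := hgrow n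
  have hne : (Finset.univ.filter fun q => Sim φ (negativeWords ℓ L) (p k) q).Nonempty :=
    ⟨p k, by simp [Sim.refl]⟩
  obtain ⟨q, hq, hmax⟩ := Finset.exists_max_image _ (fun q => φ z (p 0) q) hne
  have hq' := (Finset.mem_filter.1 hq).2
  have hle : n.choose k ≤ C * Fintype.card σ * φ z (p 0) q := by
    refine hz3.trans ?_
    rw [mul_assoc]
    refine Nat.mul_le_mul_left _ ?_
    calc _ ≤ ∑ x with Sim φ (negativeWords ℓ L) (p k) x, φ z (p 0) q := Finset.sum_le_sum hmax
      _ ≤ _ := by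
        rw [Finset.sum_const, smul_eq_mul]
        exact Nat.mul_le_mul_right _ (Finset.card_le_univ _)
  refine ⟨e * z * b q, ?_, ?_, s, hs, f, hf, ?_⟩
  · rw [FreeMonoid.length_mul, FreeMonoid.length_mul]
    nlinarith
  · have : (b q).length ≤ B := Finset.le_sup (f := fun q => (b q).length) (Finset.mem_univ q)
    rw [FreeMonoid.length_mul, FreeMonoid.length_mul]
    omega
  · refine hle.trans (Nat.mul_le_mul_left _ (le_trans ?_ (pathCount_trim_le M _ _ _)))
    have h3 := mul_apply_le φ e z s (p 0) q
    have h4 := mul_apply_le φ (e * z) (b q) s q f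
    exact (Nat.le_mul_of_pos_left _ hsp).trans (h3.trans
      ((Nat.le_mul_of_pos_right _ (hb q hq')).trans h4))

end Blocks

/-! ### The lower bound on the number of states -/

section LowerBound

variable {m q r : ℕ}

/-- The graph of `x` as a letter. -/
def graphLetter (h : r * q ≤ r ^ 32) (x : Fin r → Fin q) : Letter r :=
  ⟨Finset.univ.map ⟨fun l => Fin.castLE h (finProdFinEquiv (l, x l)), fun l l' hl => by
    have := finProdFinEquiv.injective (Fin.castLE_injective h hl)
    exact congrArg Prod.fst this⟩, by simp⟩

lemma graphLetter_inter_nonempty (h : r * q ≤ r ^ 32) (x y : Fin r → Fin q) :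
    ((graphLetter h x).1 ∩ (graphLetter h y).1).Nonempty ↔ Agree x y := by
  constructor
  · rintro ⟨z, hz⟩
    obtain ⟨h1, h2⟩ := Finset.mem_inter.1 hz
    obtain ⟨l, -, rfl⟩ := Finset.mem_map.1 h1
    obtain ⟨l', -, hl'⟩ := Finset.mem_map.1 h2
    have := finProdFinEquiv.injective (Fin.castLE_injective h hl')
    have h3 : l' = l := congrArg Prod.fst this
    have h4 : y l' = x l := congrArg Prod.snd this
    exact ⟨l, by rw [← h4, h3]⟩
  · rintro ⟨l, hl⟩
    refine ⟨Fin.castLE h (finProdFinEquiv (l, x l)), Finset.mem_inter.2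
      ⟨Finset.mem_map.2 ⟨l, Finset.mem_univ _, rfl⟩, Finset.mem_map.2 ⟨l, Finset.mem_univ _, ?_⟩⟩⟩
    rw [hl]
    rfl

lemma mem_nonDisjointness_mul {x y : Letter r} {w : List (Letter r)} {L : Language (Letter r)} :
    x :: y :: w ∈ nonDisjointness r * L ↔ (x.1 ∩ y.1).Nonempty ∧ w ∈ L := by
  rw [Language.mem_mul]
  constructor
  · rintro ⟨_, ⟨x', y', rfl, h⟩, v, hv, heq⟩
    simp only [List.cons_append, List.nil_append, List.cons.injEq] at heq
    obtain ⟨rfl, rfl, rfl⟩ := heq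
    exact ⟨h, hv⟩
  · rintro ⟨h, hw⟩
    exact ⟨[x, y], ⟨x, y, rfl, h⟩, w, hw, rfl⟩

/-- The word consisting of the given pairs of letters. -/
def pairWord {α : Type} (l : List (α × α)) : FreeMonoid α :=
  (l.map fun p => FreeMonoid.of p.1 * FreeMonoid.of p.2).prod

lemma length_pairWord {α : Type} (l : List (α × α)) : (pairWord l).toList.length = 2 * l.length := by
  induction l with
  | nil => rfl
  | cons p l ih =>
    rw [pairWord, List.map_cons, List.prod_cons, ← pairWord, FreeMonoid.toList_mul,
      List.length_append, ih, List.length_cons]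
    simp
    omega

lemma pairWord_mem_pow (l : List (Letter r × Letter r)) :
    (pairWord l).toList ∈ nonDisjointness r ^ l.length ↔ ∀ p ∈ l, (p.1.1 ∩ p.2.1).Nonempty := by
  induction l with
  | nil => simp [pairWord]
  | cons p l ih =>
    have : (pairWord (p :: l)).toList = p.1 :: p.2 :: (pairWord l).toList := rfl
    rw [this, List.length_cons, pow_succ', mem_nonDisjointness_mul, ih]
    simp

namespace IsMinIdempotent

variable {W Q : Type*} [Monoid W] [Fintype Q] [DecidableEq Q] {φ : W →* Matrix Q Q ℕ}
  {D : Submonoid W} {e : W} (he : IsMinIdempotent φ D e)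

open Classical in
/-- The number of paths on `u` from a state reachable from `p` on `e`, to a state from which `e`
leads to a fixed state equivalent to `p`. -/
noncomputable def innerReturns (_ : IsMinIdempotent φ D e) (u : W) (p : Q) : ℕ :=
  ∑ a, ∑ b, (if Leads φ e p a then 1 else 0) * φ u a b *
    (if ∃ q, (Leads φ e q q ∧ Sim φ D p q) ∧ Leads φ e b q then 1 else 0)

/-- The averaging argument requires start and end vectors with entries at most one, whereas
`returns` counts paths on `e` with multiplicity. The truncated count is smaller but still positive
when `returns` is, so both are one on negative blocks. -/
lemma innerReturns_le (u : W) (p : Q) : he.innerReturns u p ≤ he.returns u p := by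
  classical
  have : he.returns u p = ∑ a, ∑ b, φ e p a * φ u a b *
      ∑ q with Leads φ e q q ∧ Sim φ D p q, φ e b q := by
    unfold returns
    simp only [map_mul, Matrix.mul_apply, Finset.mul_sum, Finset.sum_mul]
    rw [Finset.sum_comm]
    simp only [Finset.sum_comm (s := Finset.filter _ _)]
    rw [Finset.sum_comm]
  rw [this]
  refine Finset.sum_le_sum fun a _ => Finset.sum_le_sum fun b _ =>
    Nat.mul_le_mul (Nat.mul_le_mul_right _ ?_) ?_
  · split_ifs with h
    · exact h
    · exact Nat.zero_le _
  · split_ifs with h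
    · obtain ⟨q, hq, hb⟩ := h
      exact (show 1 ≤ φ e b q from hb).trans
        (Finset.single_le_sum (f := fun q => φ e b q) (fun _ _ => Nat.zero_le _) (by simpa using hq))
    · exact Nat.zero_le _

lemma innerReturns_pos {u : W} {p : Q} (h : 0 < he.returns u p) : 0 < he.innerReturns u p := by
  classical
  unfold returns at h
  obtain ⟨q, hq, h⟩ := Finset.exists_ne_zero_of_sum_ne_zero h.ne'
  have hl : Leads φ (e * u * e) p q := Nat.pos_of_ne_zero h
  obtain ⟨b, h1, hb⟩ := leads_mul.1 hl
  obtain ⟨a, ha, hab⟩ := leads_mul.1 h1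
  refine Finset.sum_pos' (fun _ _ => Nat.zero_le _) ⟨a, Finset.mem_univ _,
    Finset.sum_pos' (fun _ _ => Nat.zero_le _) ⟨b, Finset.mem_univ _, ?_⟩⟩
  rw [if_pos ha, if_pos ⟨q, by simpa using hq, hb⟩, one_mul, mul_one]
  exact hab

end IsMinIdempotent

variable {σ : Type} [Fintype σ]

/-- The lower bound on the number of states, in terms of two numerical conditions. -/
theorem not_isLittleO_of_numeric {k n : ℕ} (hn : 0 < n) (hr : 128 * n ≤ r) (hr' : r ≤ 256 * n)
    (ht : 0 < iterations r) {M : NFA (Letter r) σ} (hacc : M.accepts = hierarchyLanguage r k)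
    (hnum₁ : 4 * (Fintype.card σ : ℝ) * (1 - (1 / 2) ^ 35) ^ iterations r ≤ 1)
    (hnum₂ : 4 * (Fintype.card σ : ℝ) ^ (2 * iterations r + 3) * iterations r *
      2 ^ iterations r ≤ 2 ^ n) :
    ¬ (fun n : ℕ => (ambiguity M n : ℝ)) =o[atTop] fun n : ℕ => (n : ℝ) ^ k := by
  classical
  intro ho
  set t := iterations r with htdef
  set L := iteratedNonDisjointness r with hL
  have hφ := loopUnambiguous_trim ho
  obtain ⟨e, he⟩ := exists_isMinIdempotent (pathCount (trim M)) (negativeWords (2 * t) L)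
  -- The grid carrying the graphs of functions has to fit into the ground set of the letters.
  have hq : r * (16 * n) ≤ r ^ 32 := by
    have h1 : 1 ≤ r := by omega
    calc r * (16 * n) ≤ r * r := Nat.mul_le_mul_left _ (by omega)
      _ = r ^ 2 := (sq r).symm
      _ ≤ r ^ 32 := Nat.pow_le_pow_right h1 (by norm_num)
  let P : (Fin r → Fin (16 * n)) → Matrix σ σ ℕ := fun x =>
    pathCount (trim M) (FreeMonoid.of (graphLetter hq x))
  let I : {p // Leads (pathCount (trim M)) e p p} → σ → ℕ := fun p a =>
    if Leads (pathCount (trim M)) e p.1 a then 1 else 0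
  let F : {p // Leads (pathCount (trim M)) e p p} → σ → ℕ := fun p b =>
    if ∃ q, (Leads (pathCount (trim M)) e q q ∧
      Sim (pathCount (trim M)) (negativeWords (2 * t) L) p.1 q) ∧
      Leads (pathCount (trim M)) e b q then 1 else 0
  let word : (Fin t → (Fin r → Fin (16 * n)) × (Fin r → Fin (16 * n))) → FreeMonoid (Letter r) :=
    fun u => pairWord (List.ofFn fun j => (graphLetter hq (u j).1, graphLetter hq (u j).2))
  have hpaths : ∀ p u, pairPaths P P (I p) (F p) u = he.innerReturns (word u) p.1 := by
    intro p u
    have : pathCount (trim M) (word u) = (List.ofFn fun j => P (u j).1 * P (u j).2).prod := by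
      simp only [word, pairWord]
      rw [map_list_prod, List.map_map, List.map_ofFn]
      simp only [Function.comp_def, map_mul]
      rfl
    simp only [pairPaths, IsMinIdempotent.innerReturns, this]
    rfl
  have hlen : ∀ u, (word u).toList.length = 2 * t := fun u => by
    rw [length_pairWord, List.length_ofFn]
  have hmem : ∀ u, (word u).toList ∈ L ↔ ∀ j, Agree (u j).1 (u j).2 := by
    intro u
    have := pairWord_mem_pow (r := r)
      (List.ofFn fun j => (graphLetter hq (u j).1, graphLetter hq (u j).2))
    rw [List.length_ofFn] at this
    refine this.trans ?_
    simp [List.mem_ofFn, graphLetter_inter_nonempty]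
  have hone : ∀ p, ∀ u : Fin t → (Fin r → Fin (16 * n)) × (Fin r → Fin (16 * n)),
      (∃ j, ¬ Agree (u j).1 (u j).2) → pairPaths P P (I p) (F p) u = 1 := by
    rintro p u ⟨j, hj⟩
    rw [hpaths]
    have hneg : word u ∈ negativeWords (2 * t) L :=
      BlockCount.of_notMem (hlen u) fun h => hj ((hmem u).1 h j)
    have h1 := he.returns_eq_one hφ hneg p.2
    have h2 := he.innerReturns_le (word u) p.1
    have h3 := he.innerReturns_pos (u := word u) (p := p.1) (by omega)
    omega
  obtain ⟨u, hu, hcard⟩ := exists_sequence_card_le (q := 16 * n) rfl hn (by omega) hr' P P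
    (fun x a b => pathCount_of_le_one _ _ a b) (fun x a b => pathCount_of_le_one _ _ a b) I F
    (Fintype.card_subtype_le _) (fun p a => by simp only [I]; split_ifs <;> simp)
    (fun p a => by simp only [F]; split_ifs <;> simp) t hone hnum₁ hnum₂
  refine false_of_card_le_returns (by omega) hacc ho he
    (BlockCount.of_mem (hlen u) ((hmem u).2 hu)) (hcard.trans ?_)
  refine Finset.sum_le_sum fun p _ => ?_
  rw [hpaths]
  exact he.innerReturns_le _ _

lemma iterations_pos (hr : 0 < r) : 0 < iterations r :=
  Nat.floor_pos.2 (Real.one_le_rpow (by exact_mod_cast hr) (by norm_num))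

lemma iterations_le (r : ℕ) : (iterations r : ℝ) ≤ (r : ℝ) ^ (1 / 3 : ℝ) :=
  Nat.floor_le (by positivity)

lemma nil_mem_hierarchyLanguage {k : ℕ} (hk : 1 ≤ k) (hr : 0 < r) :
    [] ∉ hierarchyLanguage r k := by
  have h := (BlockCount.one (L := iteratedNonDisjointness r)).mem_atLeast_iff
    (ℓ := 2 * iterations r) (k := k) (by have := iterations_pos hr; omega)
  intro h'
  have := h.1 h'
  omega

lemma hierarchyLanguage_nonempty (r k : ℕ) : ∃ w, w ∈ hierarchyLanguage r k := by
  classical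
  have hle : r ≤ r ^ 32 := Nat.le_self_pow (by norm_num) r
  obtain ⟨x, hx⟩ : ∃ x : Finset (Fin (r ^ 32)), x.card = r := by
    obtain ⟨x, -, hx⟩ := Finset.exists_subset_card_eq (s := (Finset.univ : Finset (Fin (r ^ 32))))
      (n := r) (by simpa using hle)
    exact ⟨x, hx⟩
  let a : Letter r := ⟨x, hx⟩
  have hb : (pairWord (List.replicate (iterations r) (a, a))).toList ∈ iteratedNonDisjointness r := by
    have := pairWord_mem_pow (List.replicate (iterations r) (a, a))
    rw [List.length_replicate] at this
    refine this.2 fun p hp => ?_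
    have hp' := List.mem_replicate.1 hp
    rw [hp'.2, Finset.inter_self, ← Finset.card_pos, hx]
    rcases Nat.eq_zero_or_pos r with rfl | h
    · simp [iterations] at hp'
    · exact h
  have hl : (pairWord (List.replicate (iterations r) (a, a))).toList.length = 2 * iterations r := by
    rw [length_pairWord, List.length_replicate]
  refine ⟨_, List.replicate k (pairWord (List.replicate (iterations r) (a, a))).toList, ?_, rfl, ?_⟩
  · intro u hu
    rw [List.eq_of_mem_replicate hu, hl]
  · rw [List.countP_replicate]
    simp [hb]

lemma one_le_card_of_accepts {k : ℕ} {M : NFA (Letter r) σ}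
    (hacc : M.accepts = hierarchyLanguage r k) : 1 ≤ Fintype.card σ := by
  obtain ⟨w, hw⟩ := hierarchyLanguage_nonempty r k
  rw [← hacc] at hw
  obtain ⟨s, -, -⟩ := hw
  exact Fintype.card_pos_iff.2 ⟨s⟩

lemma two_le_card_of_accepts {k : ℕ} (hk : 1 ≤ k) (hr : 0 < r) {M : NFA (Letter r) σ}
    (hacc : M.accepts = hierarchyLanguage r k) : 2 ≤ Fintype.card σ := by
  classical
  by_contra hlt
  have hsub : Subsingleton σ := Fintype.card_le_one_iff_subsingleton.1 (by omega)
  obtain ⟨w, hw⟩ := hierarchyLanguage_nonempty r k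
  rw [← hacc, mem_accepts_iff_leads] at hw
  obtain ⟨s, hs, f, hf, -⟩ := hw
  refine nil_mem_hierarchyLanguage hk hr ?_
  rw [← hacc]
  exact ⟨s, Subsingleton.elim f s ▸ hf, hs⟩

/-- Automata of small ambiguity for the hierarchy language are large. -/
theorem two_rpow_le_card {k : ℕ} (hk : 1 ≤ k) {M : NFA (Letter r) σ}
    (hacc : M.accepts = hierarchyLanguage r k)
    (ho : (fun n : ℕ => (ambiguity M n : ℝ)) =o[atTop] fun n : ℕ => (n : ℝ) ^ k) :
    (2 : ℝ) ^ ((r : ℝ) ^ (1 / 3 : ℝ) / 2 ^ 38) ≤ Fintype.card σ := by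
  set x : ℝ := (r : ℝ) ^ (1 / 3 : ℝ) with hx
  have hx0 : 0 ≤ x := by positivity
  have hx3 : x ^ 3 = r := by
    rw [hx, ← Real.rpow_natCast, ← Real.rpow_mul (by positivity)]
    norm_num
  rcases le_or_gt (2 ^ 38) x with hbig | hsmall
  · by_contra hlt
    push Not at hlt
    have hr : 128 ≤ r := by
      have h1 : ((128 : ℕ) : ℝ) ≤ r := by
        rw [← hx3]
        calc ((128 : ℕ) : ℝ) ≤ (2 ^ 38) ^ 3 := by norm_num
          _ ≤ x ^ 3 := pow_le_pow_left₀ (by norm_num) hbig 3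
      exact_mod_cast h1
    have htl : x - 1 ≤ (iterations r : ℝ) := (Nat.sub_one_lt_floor x).le
    -- This choice gives `128 * n ≤ r ≤ 256 * n`, so that `r` columns are at least `8 * q` for `q =
    -- 16 * n`.
    refine not_isLittleO_of_numeric (n := r / 128) (by omega) (by omega) (by omega)
      (iterations_pos (by omega)) hacc (numeric_bound₁ hbig htl hlt.le)
      (numeric_bound₂ hbig (iterations_le r) (by positivity) hlt.le ?_) ho
    rw [hx3]
    have : r ≤ 128 * (r / 128) + 128 := by omega
    exact_mod_cast this
  -- For small `x` the claimed bound is at most `2`, and two states are needed because the empty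
  -- word is not in the language. For `r = 0` the bound is just `1`.
  · rcases Nat.eq_zero_or_pos r with rfl | hr
    · have := one_le_card_of_accepts hacc
      have hx00 : x = 0 := by rw [hx]; simp
      rw [hx00]
      simpa using this
    · have h2 : (2 : ℝ) ≤ Fintype.card σ := by exact_mod_cast two_le_card_of_accepts hk hr hacc
      refine le_trans ?_ h2
      calc (2 : ℝ) ^ (x / 2 ^ 38) ≤ 2 ^ (1 : ℝ) := by
            apply Real.rpow_le_rpow_of_exponent_le (by norm_num)
            rw [div_le_one (by positivity)]
            exact hsmall.le
        _ = 2 := by norm_num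

end LowerBound

/-! ### The guessing automaton -/

section UpperBound

variable {α σ : Type} [Fintype σ]

/-- The languages of the states of an automaton are determined by their quotients. -/
lemma mem_accepts_of_quotients {M : NFA α σ} {K : σ → Language α}
    (hnil : ∀ q, [] ∈ K q ↔ q ∈ M.accept)
    (hcons : ∀ q a w, a :: w ∈ K q ↔ ∃ q' ∈ M.step q a, w ∈ K q') (w : List α) :
    w ∈ M.accepts ↔ ∃ s ∈ M.start, w ∈ K s := by
  classical
  rw [mem_accepts_iff_leads]
  refine exists_congr fun s => and_congr_right fun hs => ?_
  clear hs
  induction w generalizing s with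
  | nil =>
    rw [hnil]
    constructor
    · rintro ⟨f, hf, h⟩
      obtain rfl : s = f := by
        by_contra hne
        simp [Leads, hne] at h
      exact hf
    · exact fun h => ⟨s, h, leads_one s⟩
  | cons a w ih =>
    rw [hcons, FreeMonoid.ofList_cons]
    simp only [leads_mul, leads_of]
    constructor
    · rintro ⟨f, hf, m, hm, h⟩
      exact ⟨m, hm, (ih m).1 ⟨f, hf, h⟩⟩
    · rintro ⟨m, hm, h⟩
      obtain ⟨f, hf, h⟩ := (ih m).2 h
      exact ⟨f, hf, m, hm, h⟩

lemma wordAmbiguity_of_start [DecidableEq σ] {M : NFA α σ} {s : σ} (h : M.start = {s}) (w : List α) :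
    wordAmbiguity M w = (runsFrom M w s).card := by
  rw [wordAmbiguity_eq, Finset.sum_filter]
  simp [h]

open Classical in
/-- A potential that decreases along the transitions bounds the number of runs. -/
lemma card_runsFrom_le [DecidableEq σ] {M : NFA α σ} {V : σ → ℕ → ℕ} (hnil : ∀ q ∈ M.accept, 1 ≤ V q 0)
    (hcons : ∀ q a n, ∑ q' with q' ∈ M.step q a, V q' n ≤ V q (n + 1)) (w : List α) (q : σ) :
    (runsFrom M w q).card ≤ V q w.length := by
  induction w generalizing q with
  | nil =>
    rw [card_runsFrom_nil]
    split_ifs with h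
    · exact hnil q h
    · exact Nat.zero_le _
  | cons a w ih =>
    rw [card_runsFrom_cons]
    exact (Finset.sum_le_sum fun q' _ => ih q').trans (hcons q a w.length)

lemma sum_le_card_mul {ι κ : Type*} [DecidableEq ι] {s : Finset ι} {t : Finset κ} (f : κ → ι)
    (h : ∀ i ∈ s, ∃ j ∈ t, f j = i) {V : ι → ℕ} {c : ℕ} (hV : ∀ j, V (f j) ≤ c) :
    ∑ i ∈ s, V i ≤ t.card * c := by
  have hs : s ⊆ t.image f := fun i hi => Finset.mem_image.2 (h i hi)
  calc ∑ i ∈ s, V i ≤ ∑ _i ∈ s, c := Finset.sum_le_sum fun i hi => by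
        obtain ⟨j, -, rfl⟩ := h i hi
        exact hV j
    _ = s.card * c := by rw [Finset.sum_const, smul_eq_mul]
    _ ≤ _ := Nat.mul_le_mul_right _ ((Finset.card_le_card hs).trans Finset.card_image_le)

lemma nil_mem_atLeast {ℓ k : ℕ} (hℓ : 0 < ℓ) {L : Language α} : [] ∈ atLeast ℓ k L ↔ k = 0 := by
  have h := (BlockCount.one (L := L)).mem_atLeast_iff (ℓ := ℓ) (k := k) hℓ
  exact h.trans Nat.le_zero

lemma append_mem_atLeast {ℓ k : ℕ} {L : Language α} {b w : List α} (hb : b.length = ℓ) :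
    (w ∈ atLeast ℓ k L → b ++ w ∈ atLeast ℓ k L) ∧
      (b ∈ L → w ∈ atLeast ℓ k L → b ++ w ∈ atLeast ℓ (k + 1) L) := by
  have hall : ∀ ws : List (List α), (∀ u ∈ ws, u.length = ℓ) → ∀ u ∈ b :: ws, u.length = ℓ := by
    intro ws h u hu
    rcases List.mem_cons.1 hu with rfl | hu
    · exact hb
    · exact h u hu
  constructor
  · rintro ⟨ws, h1, h2, h3⟩
    refine ⟨b :: ws, hall ws h1, by rw [h2, List.flatten_cons], h3.trans ?_⟩
    rw [List.countP_cons]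
    exact Nat.le_add_right _ _
  · rintro hL ⟨ws, h1, h2, h3⟩
    refine ⟨b :: ws, hall ws h1, by rw [h2, List.flatten_cons], ?_⟩
    rw [List.countP_cons_of_pos (by simpa using hL)]
    omega

lemma exists_block_of_mem_atLeast {ℓ k : ℕ} {L : Language α} {a : α} {w : List α}
    (h : a :: w ∈ atLeast ℓ k L) : ∃ b w', a :: w = b ++ w' ∧ b.length = ℓ ∧
      (w' ∈ atLeast ℓ k L ∨ b ∈ L ∧ ∃ k', k' + 1 = k ∧ w' ∈ atLeast ℓ k' L) := by
  obtain ⟨ws, h1, h2, h3⟩ := h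
  cases ws with
  | nil => simp at h2
  | cons b ws =>
    refine ⟨b, ws.flatten, by rw [h2, List.flatten_cons], h1 b (by simp), ?_⟩
    have h1' : ∀ u ∈ ws, u.length = ℓ := fun u hu => h1 u (List.mem_cons_of_mem _ hu)
    by_cases hb : b ∈ L
    · rw [List.countP_cons_of_pos (by simpa using hb)] at h3
      rcases k with _ | k
      · exact Or.inl ⟨ws, h1', rfl, Nat.zero_le _⟩
      · exact Or.inr ⟨hb, k, rfl, ws, h1', rfl, by omega⟩
    · rw [List.countP_cons_of_neg (by simpa using hb)] at h3
      exact Or.inl ⟨ws, h1', rfl, h3⟩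

/-- The words that consist of `m` arbitrary letters and a word of `K`. -/
def afterLetters (m : ℕ) (K : Language α) : Language α :=
  {w | ∃ v w', w = v ++ w' ∧ v.length = m ∧ w' ∈ K}

lemma afterLetters_zero (K : Language α) : afterLetters 0 K = K := by
  ext w
  constructor
  · rintro ⟨v, w', rfl, hv, hw⟩
    rwa [List.length_eq_zero_iff.1 hv]
  · exact fun h => ⟨[], w, rfl, rfl, h⟩

lemma cons_mem_afterLetters {m : ℕ} {K : Language α} {a : α} {w : List α} :
    a :: w ∈ afterLetters (m + 1) K ↔ w ∈ afterLetters m K := by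
  constructor
  · rintro ⟨v, w', h, hv, hw⟩
    cases v with
    | nil => simp at hv
    | cons b v =>
      obtain ⟨-, h⟩ := List.cons.inj h
      exact ⟨v, w', h, by simpa using hv, hw⟩
  · rintro ⟨v, w', rfl, hv, hw⟩
    exact ⟨a :: v, w', rfl, by simp [hv], hw⟩

variable {r : ℕ}

/-- The words that consist of a letter containing `z` and a word of `K`. -/
def afterHit (z : Fin (r ^ 32)) (K : Language (Letter r)) : Language (Letter r) :=
  {w | ∃ y v, w = y :: v ∧ z ∈ y.1 ∧ v ∈ K}

lemma cons_mem_afterHit {z : Fin (r ^ 32)} {K : Language (Letter r)} {a : Letter r}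
    {w : List (Letter r)} : a :: w ∈ afterHit z K ↔ z ∈ a.1 ∧ w ∈ K := by
  constructor
  · rintro ⟨y, v, h, hz, hv⟩
    obtain ⟨rfl, rfl⟩ := List.cons.inj h
    exact ⟨hz, hv⟩
  · exact fun h => ⟨a, w, rfl, h.1, h.2⟩

lemma nil_notMem_afterHit {z : Fin (r ^ 32)} {K : Language (Letter r)} : [] ∉ afterHit z K := by
  rintro ⟨y, v, h, -⟩
  simp at h

lemma cons_mem_nonDisjointness_mul {K : Language (Letter r)} {a : Letter r} {w : List (Letter r)} :
    a :: w ∈ nonDisjointness r * K ↔ ∃ z ∈ a.1, w ∈ afterHit z K := by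
  constructor
  · rw [Language.mem_mul]
    rintro ⟨_, ⟨x, y, rfl, z, hz⟩, v, hv, heq⟩
    simp only [List.cons_append, List.nil_append, List.cons.injEq] at heq
    obtain ⟨rfl, rfl⟩ := heq
    obtain ⟨h1, h2⟩ := Finset.mem_inter.1 hz
    exact ⟨z, h1, y, v, rfl, h2, hv⟩
  · rintro ⟨z, hz, y, v, rfl, hy, hv⟩
    exact mem_nonDisjointness_mul.2 ⟨⟨z, Finset.mem_inter.2 ⟨hz, hy⟩⟩, hv⟩

lemma nil_notMem_nonDisjointness_mul {K : Language (Letter r)} : [] ∉ nonDisjointness r * K := by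
  rw [Language.mem_mul]
  rintro ⟨_, ⟨x, y, rfl, -⟩, v, -, heq⟩
  simp at heq

lemma length_of_mem_pow {w : List (Letter r)} {n : ℕ} (h : w ∈ nonDisjointness r ^ n) :
    w.length = 2 * n := by
  induction n generalizing w with
  | zero =>
    rw [pow_zero, Language.mem_one] at h
    simp [h]
  | succ n ih =>
    rw [pow_succ', Language.mem_mul] at h
    obtain ⟨_, ⟨x, y, rfl, -⟩, v, hv, rfl⟩ := h
    simp [ih hv]
    omega

/-- The states of the guessing automaton. The states `Sum.inl (n, m)` still have to find `n`
positive blocks and ignore the next `m` letters. The states `Sum.inr (n, j, o)` check a block, after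
which `n` positive blocks remain to be found: `j` or `j + 1` further pairs of letters remain to be
checked in the block, depending on whether the automaton has guessed a common element of the present
pair. -/
abbrev GuessState (r k t : ℕ) : Type :=
  (Fin (k + 1) × Fin (2 * t)) ⊕ (Fin k × Fin t × Option (Fin (r ^ 32)))

/-- The transitions of the guessing automaton. -/
def guessStep (r k t : ℕ) (q : GuessState r k t) (a : Letter r) : GuessState r k t → Prop :=
  match q with
  | Sum.inl (n, m) => fun
    | Sum.inl (n', m') => n' = n ∧ (m'.val + 1 = m.val ∨ m.val = 0 ∧ m'.val + 1 = 2 * t)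
    | Sum.inr (_, _, none) => False
    | Sum.inr (n', j, some z) => n'.succ = n ∧ m.val = 0 ∧ j.val + 1 = t ∧ z ∈ a.1
  | Sum.inr (n, j, none) => fun
    | Sum.inl _ => False
    | Sum.inr (_, _, none) => False
    | Sum.inr (n', j', some z) => n' = n ∧ j' = j ∧ z ∈ a.1
  | Sum.inr (n, j, some z) => fun
    | Sum.inl (n', m') => z ∈ a.1 ∧ n' = n.castSucc ∧ j.val = 0 ∧ m'.val = 0
    | Sum.inr (n', j', none) => z ∈ a.1 ∧ n' = n ∧ j'.val + 1 = j.val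
    | Sum.inr (_, _, some _) => False

/-- The automaton that guesses `k` blocks and verifies that they are in the iterated language of
non-disjointness. -/
def guessNFA (r k t : ℕ) (ht : 0 < t) : NFA (Letter r) (GuessState r k t) where
  step q a := {q' | guessStep r k t q a q'}
  start := {Sum.inl (Fin.last k, ⟨0, by omega⟩)}
  accept := {Sum.inl (0, ⟨0, by omega⟩)}

/-- The language of a state of the guessing automaton. -/
def guessLanguage (r k t : ℕ) : GuessState r k t → Language (Letter r)
  | Sum.inl (n, m) => afterLetters m.val (atLeast (2 * t) n.val (nonDisjointness r ^ t))
  | Sum.inr (n, j, none) =>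
    nonDisjointness r * (nonDisjointness r ^ j.val * atLeast (2 * t) n.val (nonDisjointness r ^ t))
  | Sum.inr (n, j, some z) =>
    afterHit z (nonDisjointness r ^ j.val * atLeast (2 * t) n.val (nonDisjointness r ^ t))

/-- The first block is either ignored, or declared positive and verified, beginning with a guessed
element `z` of its first letter. Ignoring a positive block is allowed, since "at least `k`" only
needs `k` chosen ones. -/
lemma cons_mem_atLeast_iff {n t : ℕ} (ht : 0 < t) {a : Letter r} {w : List (Letter r)} :
    a :: w ∈ atLeast (2 * t) n (nonDisjointness r ^ t) ↔
      w ∈ afterLetters (2 * t - 1) (atLeast (2 * t) n (nonDisjointness r ^ t)) ∨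
      ∃ n', n' + 1 = n ∧ ∃ z ∈ a.1, w ∈ afterHit z (nonDisjointness r ^ (t - 1) *
        atLeast (2 * t) n' (nonDisjointness r ^ t)) := by
  obtain ⟨t, rfl⟩ : ∃ t', t = t' + 1 := ⟨t - 1, by omega⟩
  have h2 : 2 * (t + 1) - 1 + 1 = 2 * (t + 1) := by omega
  rw [← cons_mem_afterLetters (a := a), h2]
  simp only [← cons_mem_nonDisjointness_mul, Nat.add_sub_cancel]
  simp only [← mul_assoc, ← pow_succ' (nonDisjointness r)]
  constructor
  · intro h
    obtain ⟨b, w', heq, hb, h | ⟨hbL, n', hn', hw'⟩⟩ := exists_block_of_mem_atLeast h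
    · exact Or.inl ⟨b, w', heq, hb, h⟩
    · exact Or.inr ⟨n', hn', by rw [heq]; exact Language.append_mem_mul hbL hw'⟩
  · rintro (⟨v, w', heq, hv, hw⟩ | ⟨n', rfl, h⟩)
    · rw [heq]
      exact (append_mem_atLeast hv).1 hw
    · obtain ⟨v, hv, w', hw, heq⟩ := Language.mem_mul.1 h
      rw [← heq]
      exact (append_mem_atLeast (length_of_mem_pow hv)).2 hv hw

variable {k t : ℕ} (ht : 0 < t)

lemma guessLanguage_nil (q : GuessState r k t) :
    [] ∈ guessLanguage r k t q ↔ q ∈ (guessNFA r k t ht).accept := by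
  rcases q with ⟨n, m⟩ | ⟨n, j, _ | z⟩
  · have h0 : (0 : Fin (k + 1)) = ⟨0, by omega⟩ := rfl
    simp only [guessLanguage, guessNFA, Set.mem_singleton_iff, Sum.inl.injEq, Prod.mk.injEq,
      Fin.ext_iff, Fin.val_zero]
    constructor
    · rintro ⟨v, w', h, hv, hw⟩
      obtain ⟨rfl, rfl⟩ := List.append_eq_nil_iff.1 h.symm
      exact ⟨(nil_mem_atLeast (by omega)).1 hw, hv.symm⟩
    · rintro ⟨hn, hm⟩
      rw [hm, afterLetters_zero]
      exact (nil_mem_atLeast (by omega)).2 hn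
  · simp only [guessLanguage, guessNFA, Set.mem_singleton_iff, reduceCtorEq, iff_false]
    exact nil_notMem_nonDisjointness_mul
  · simp only [guessLanguage, guessNFA, Set.mem_singleton_iff, reduceCtorEq, iff_false]
    exact nil_notMem_afterHit

lemma guessLanguage_cons (q : GuessState r k t) (a : Letter r) (w : List (Letter r)) :
    a :: w ∈ guessLanguage r k t q ↔
      ∃ q' ∈ (guessNFA r k t ht).step q a, w ∈ guessLanguage r k t q' := by
  change _ ↔ ∃ q', guessStep r k t q a q' ∧ _
  rcases q with ⟨n, m⟩ | ⟨n, j, _ | z⟩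
  · obtain ⟨m, hm⟩ := m
    rcases m with _ | m
    · simp only [guessLanguage, afterLetters_zero, cons_mem_atLeast_iff ht]
      constructor
      · rintro (h | ⟨n', hn', z, hz, h⟩)
        · exact ⟨Sum.inl (n, ⟨2 * t - 1, by omega⟩), ⟨rfl, Or.inr ⟨rfl, by simp only []; omega⟩⟩, h⟩
        · exact ⟨Sum.inr (⟨n', by omega⟩, ⟨t - 1, by omega⟩, some z),
            ⟨Fin.ext hn', rfl, by simp only []; omega, hz⟩, h⟩
      · rintro ⟨⟨n', m'⟩ | ⟨n', j, _ | z⟩, h, hw⟩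
        · obtain ⟨rfl, h | ⟨-, h⟩⟩ := h
          · simp at h
          · left
            rw [show 2 * t - 1 = m'.val by omega]
            exact hw
        · exact h.elim
        · obtain ⟨rfl, -, hj, hz⟩ := h
          refine Or.inr ⟨n', rfl, z, hz, ?_⟩
          rw [show t - 1 = j.val by omega]
          exact hw
    · simp only [guessLanguage, cons_mem_afterLetters]
      constructor
      · exact fun h => ⟨Sum.inl (n, ⟨m, by omega⟩), ⟨rfl, Or.inl rfl⟩, h⟩
      · rintro ⟨⟨n', m'⟩ | ⟨n', j, _ | z⟩, h, hw⟩
        · obtain ⟨rfl, h | ⟨h, -⟩⟩ := h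
          · obtain rfl : m'.val = m := by simpa using h
            exact hw
          · simp at h
        · exact h.elim
        · have := h.2.1
          simp at this
  · simp only [guessLanguage, cons_mem_nonDisjointness_mul]
    constructor
    · rintro ⟨z, hz, h⟩
      exact ⟨Sum.inr (n, j, some z), ⟨rfl, rfl, hz⟩, h⟩
    · rintro ⟨⟨n', m'⟩ | ⟨n', j, _ | z⟩, h, hw⟩
      · exact h.elim
      · exact h.elim
      · obtain ⟨rfl, rfl, hz⟩ := h
        exact ⟨z, hz, hw⟩
  · simp only [guessLanguage, cons_mem_afterHit]
    constructor
    · rintro ⟨hz, h⟩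
      obtain ⟨j, hj⟩ := j
      rcases j with _ | j
      · refine ⟨Sum.inl (n.castSucc, ⟨0, by omega⟩), ⟨hz, rfl, rfl, rfl⟩, ?_⟩
        simp only [pow_zero, one_mul] at h
        simp only [afterLetters_zero]
        exact h
      · refine ⟨Sum.inr (n, ⟨j, by omega⟩, none), ⟨hz, rfl, rfl⟩, ?_⟩
        simp only [pow_succ', mul_assoc] at h
        exact h
    · rintro ⟨⟨n', m'⟩ | ⟨n', j', _ | z'⟩, h, hw⟩
      · obtain ⟨hz, rfl, hj, hm⟩ := h
        refine ⟨hz, ?_⟩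
        simp only [hm, afterLetters_zero] at hw
        rw [hj, pow_zero, one_mul]
        exact hw
      · obtain ⟨hz, rfl, hj⟩ := h
        refine ⟨hz, ?_⟩
        rw [← hj, pow_succ', mul_assoc]
        exact hw
      · exact h.elim

theorem guessNFA_accepts :
    (guessNFA r k t ht).accepts = atLeast (2 * t) k (nonDisjointness r ^ t) := by
  ext w
  rw [mem_accepts_of_quotients (guessLanguage_nil ht) (guessLanguage_cons ht)]
  simp only [guessNFA, Set.mem_singleton_iff, exists_eq_left, guessLanguage, Fin.val_last,
    afterLetters_zero]

/-- A bound for the number of runs from a state of the guessing automaton on words of length `N`. -/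
def guessPotential (r k t : ℕ) : GuessState r k t → ℕ → ℕ
  | Sum.inl (n, _), N => (r ^ t * (N + 1)) ^ n.val
  | Sum.inr (n, j, none), N => r ^ (j.val + 1) * (r ^ t * (N + 1)) ^ n.val
  | Sum.inr (n, j, some _), N => r ^ j.val * (r ^ t * (N + 1)) ^ n.val

open Classical in
-- Each positive block still to be found contributes a factor `N + 1` for its position and `r ^ t`
-- for the guessed common elements. Inside a block, the exponent of the first power of `r` counts
-- the guesses left.
lemma sum_guessPotential_le (q : GuessState r k t) (a : Letter r) (N : ℕ) :
    ∑ q' with q' ∈ (guessNFA r k t ht).step q a, guessPotential r k t q' N ≤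
      guessPotential r k t q (N + 1) := by
  change ∑ q' with guessStep r k t q a q', _ ≤ _
  have hmono : ∀ n, (r ^ t * (N + 1)) ^ n ≤ (r ^ t * (N + 1 + 1)) ^ n := fun n =>
    Nat.pow_le_pow_left (Nat.mul_le_mul_left _ (by omega)) n
  rcases q with ⟨n, m⟩ | ⟨n, j, _ | z⟩
  · by_cases hm : m.val = 0
    · have hsub : (Finset.univ.filter fun q' => guessStep r k t (Sum.inl (n, m)) a q') ⊆
          {Sum.inl (n, ⟨2 * t - 1, by omega⟩)} ∪
          Finset.univ.filter fun q' => guessStep r k t (Sum.inl (n, m)) a q' ∧ q'.isRight := by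
        intro q' hq'
        have h := (Finset.mem_filter.1 hq').2
        rcases q' with ⟨n', m'⟩ | q'
        · obtain ⟨rfl, h | ⟨-, h⟩⟩ := h
          · omega
          · refine Finset.mem_union_left _ (Finset.mem_singleton.2 ?_)
            congr 2
            exact Fin.ext (by simp only []; omega)
        · exact Finset.mem_union_right _ (by simp [h])
      refine (Finset.sum_le_sum_of_subset hsub).trans ((Nat.le_add_right _ _).trans
        ((Finset.sum_union_inter).le.trans ?_))
      rw [Finset.sum_singleton]
      obtain ⟨n, hn⟩ := n
      rcases n with _ | n
      · rw [Finset.filter_false_of_mem]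
        · simp [guessPotential]
        · rintro (q' | ⟨n', j, _ | z⟩) - ⟨h, h'⟩
          · simp at h'
          · exact h
          · have := congrArg Fin.val h.1
            simp at this
      · have hle := sum_le_card_mul (s := Finset.univ.filter fun q' =>
          guessStep r k t (Sum.inl (⟨n + 1, hn⟩, m)) a q' ∧ q'.isRight) (t := a.1)
          (fun z => Sum.inr (⟨n, by omega⟩, ⟨t - 1, by omega⟩, some z)) ?_
          (V := fun q' => guessPotential r k t q' N)
          (c := r ^ (t - 1) * (r ^ t * (N + 1)) ^ n) (fun _ => le_rfl)
        · refine (Nat.add_le_add_left hle _).trans ?_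
          rw [a.2, ← mul_assoc, ← pow_succ', Nat.sub_add_cancel ht]
          simp only [guessPotential]
          -- The first summand ignores the block, the second checks it.
          calc (r ^ t * (N + 1)) ^ (n + 1) + r ^ t * (r ^ t * (N + 1)) ^ n
              = (r ^ t * (N + 1)) ^ n * (r ^ t * (N + 1 + 1)) := by ring
            _ ≤ (r ^ t * (N + 1 + 1)) ^ n * (r ^ t * (N + 1 + 1)) :=
              Nat.mul_le_mul_right _ (hmono n)
            _ = _ := (pow_succ _ _).symm
        · intro q' hq'
          obtain ⟨h, h'⟩ := (Finset.mem_filter.1 hq').2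
          rcases q' with q' | ⟨n', j, _ | z⟩
          · simp at h'
          · exact h.elim
          · obtain ⟨h1, -, h2, h3⟩ := h
            refine ⟨z, h3, ?_⟩
            have h4 := congrArg Fin.val h1
            congr 2
            · exact Fin.ext (by simpa using h4.symm)
            · congr 1
              exact Fin.ext (by simp only []; omega)
    · have hle := sum_le_card_mul (s := Finset.univ.filter fun q' =>
        guessStep r k t (Sum.inl (n, m)) a q') (t := Finset.univ)
        (fun _ : Unit => Sum.inl (n, ⟨m.val - 1, by omega⟩)) ?_
        (V := fun q' => guessPotential r k t q' N)
        (c := (r ^ t * (N + 1)) ^ n.val) (fun _ => le_rfl)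
      · refine hle.trans ?_
        rw [Finset.card_univ, Fintype.card_unit, one_mul]
        exact hmono _
      · intro q' hq'
        have h := (Finset.mem_filter.1 hq').2
        rcases q' with ⟨n', m'⟩ | ⟨n', j, _ | z⟩
        · obtain ⟨rfl, h | ⟨h, -⟩⟩ := h
          · refine ⟨(), Finset.mem_univ _, ?_⟩
            congr 2
            exact Fin.ext (by simp only []; omega)
          · exact absurd h hm
        · exact h.elim
        · exact absurd h.2.1 hm
  · have hle := sum_le_card_mul (s := Finset.univ.filter fun q' =>
      guessStep r k t (Sum.inr (n, j, none)) a q') (t := a.1)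
      (fun z => Sum.inr (n, j, some z)) ?_
      (V := fun q' => guessPotential r k t q' N)
      (c := r ^ j.val * (r ^ t * (N + 1)) ^ n.val) (fun _ => le_rfl)
    · refine hle.trans ?_
      rw [a.2, ← mul_assoc, ← pow_succ']
      exact Nat.mul_le_mul_left _ (hmono _)
    · intro q' hq'
      have h := (Finset.mem_filter.1 hq').2
      rcases q' with q' | ⟨n', j', _ | z⟩
      · exact h.elim
      · exact h.elim
      · obtain ⟨rfl, rfl, hz⟩ := h
        exact ⟨z, hz, rfl⟩
  · have hle := sum_le_card_mul (s := Finset.univ.filter fun q' =>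
      guessStep r k t (Sum.inr (n, j, some z)) a q') (t := Finset.univ)
      (fun _ : Unit => if j.val = 0 then Sum.inl (n.castSucc, ⟨0, by omega⟩) else
        Sum.inr (n, ⟨j.val - 1, by omega⟩, none)) ?_
      (V := fun q' => guessPotential r k t q' N)
      (c := r ^ j.val * (r ^ t * (N + 1)) ^ n.val) ?_
    · refine hle.trans ?_
      rw [Finset.card_univ, Fintype.card_unit, one_mul]
      exact Nat.mul_le_mul_left _ (hmono _)
    · intro q' hq'
      have h := (Finset.mem_filter.1 hq').2
      refine ⟨(), Finset.mem_univ _, ?_⟩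
      rcases q' with ⟨n', m'⟩ | ⟨n', j', _ | z'⟩
      · obtain ⟨-, rfl, hj, hm⟩ := h
        simp only [hj, if_true]
        congr 2
        exact Fin.ext hm.symm
      · obtain ⟨-, rfl, hj⟩ := h
        rw [if_neg (by omega)]
        congr 3
        exact Fin.ext (by simp only []; omega)
      · exact h.elim
    · intro _
      by_cases hj : j.val = 0
      · simp [hj, guessPotential]
      · simp only [hj, if_false, guessPotential]
        rw [Nat.sub_add_cancel (by omega)]

lemma guessNFA_ambiguity_le (n : ℕ) :
    ambiguity (guessNFA r k t ht) n ≤ (r ^ t * (n + 1)) ^ k := by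
  classical
  refine Finset.sup_le fun w _ => ?_
  rw [wordAmbiguity_of_start rfl]
  have h := card_runsFrom_le (M := guessNFA r k t ht) (V := guessPotential r k t)
    (fun q hq => by rw [Set.mem_singleton_iff.1 hq]; simp [guessPotential])
    (sum_guessPotential_le ht) w.toList (Sum.inl (Fin.last k, ⟨0, by omega⟩))
  refine h.trans_eq ?_
  simp [guessPotential]

lemma guessNFA_isBigO :
    (fun n : ℕ => (ambiguity (guessNFA r k t ht) n : ℝ)) =O[atTop] fun n : ℕ => (n : ℝ) ^ k := by
  refine IsBigO.of_bound ((r ^ t * 2) ^ k : ℝ) ?_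
  filter_upwards [eventually_ge_atTop 1] with n hn
  rw [Real.norm_of_nonneg (by positivity), Real.norm_of_nonneg (by positivity), ← mul_pow]
  calc (ambiguity (guessNFA r k t ht) n : ℝ) ≤ (((r ^ t * (n + 1)) ^ k : ℕ) : ℝ) := by
        exact_mod_cast guessNFA_ambiguity_le ht n
    _ ≤ _ := by
        have : (n : ℝ) + 1 ≤ 2 * n := by
          have : (1 : ℝ) ≤ n := by exact_mod_cast hn
          linarith
        push_cast
        rw [mul_assoc]
        gcongr

lemma card_guessState : Fintype.card (GuessState r k t) =
    (k + 1) * (2 * t) + k * (t * (r ^ 32 + 1)) := by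
  simp

end UpperBound

/-! ### Assembling the bounds and the hierarchy -/

section Main

lemma iterations_le_self (r : ℕ) : iterations r ≤ r := by
  rcases Nat.eq_zero_or_pos r with rfl | hr
  · simp [iterations]
  · have h1 : (1 : ℝ) ≤ r := by exact_mod_cast hr
    have h : (iterations r : ℝ) ≤ r := (iterations_le r).trans
      ((Real.rpow_le_rpow_of_exponent_le h1 (by norm_num : (1 / 3 : ℝ) ≤ 1)).trans_eq
        (Real.rpow_one _))
    exact_mod_cast h

lemma card_guessState_le {r k : ℕ} (hk : 1 ≤ k) :
    Fintype.card (GuessState r k (iterations r)) ≤ k * (r * (r ^ 32 + 5)) := by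
  rw [card_guessState]
  calc (k + 1) * (2 * iterations r) + k * (iterations r * (r ^ 32 + 1))
      ≤ (k + k) * (2 * iterations r) + k * (iterations r * (r ^ 32 + 1)) := by gcongr
    _ = k * (iterations r * (r ^ 32 + 5)) := by ring
    _ ≤ _ := by gcongr; exact iterations_le_self r

/-- The automaton with one state that accepts only the empty word. -/
def nilNFA (α : Type) : NFA α Unit where
  step _ _ := ∅
  start := {()}
  accept := {()}

/-- For `r = 0` there are no iterations, so all blocks are empty and only the empty word remains.
The guessing automaton needs `0 < t` and is not available. -/
lemma nilNFA_accepts (k : ℕ) : (nilNFA (Letter 0)).accepts = hierarchyLanguage 0 k := by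
  have h0 : iterations 0 = 0 := by simp [iterations]
  ext w
  rw [mem_accepts_of_quotients (K := fun _ => 1) (fun q => by simp [nilNFA])
    (fun q a w => by simp [nilNFA, Language.mem_one])]
  simp only [nilNFA, Set.mem_singleton_iff, exists_const, true_and, Language.mem_one]
  constructor
  · rintro rfl
    refine ⟨List.replicate k [], ?_, by simp, ?_⟩
    · intro u hu
      simp [List.eq_of_mem_replicate hu, h0]
    · rw [List.countP_replicate]
      simp [iteratedNonDisjointness, h0]
  · rintro ⟨ws, h1, rfl, -⟩
    rw [List.flatten_eq_nil_iff]
    intro u hu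
    simpa [h0] using h1 u hu

lemma nilNFA_isBigO {α : Type} [Fintype α] (k : ℕ) :
    (fun n : ℕ => (ambiguity (nilNFA α) n : ℝ)) =O[atTop] fun n : ℕ => (n : ℝ) ^ k := by
  classical
  have hle : ∀ n, ambiguity (nilNFA α) n ≤ 1 := by
    intro n
    refine Finset.sup_le fun w _ => ?_
    rw [wordAmbiguity_of_start (s := ()) rfl]
    exact card_runsFrom_le (M := nilNFA α) (V := fun _ _ => 1) (fun _ _ => le_rfl)
      (fun q a n => by simp [nilNFA]) w.toList ()
  refine IsBigO.of_bound 1 ?_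
  filter_upwards [eventually_ge_atTop 1] with n hn
  rw [Real.norm_of_nonneg (by positivity), Real.norm_of_nonneg (by positivity), one_mul]
  have h1 : (ambiguity (nilNFA α) n : ℝ) ≤ 1 := by exact_mod_cast hle n
  exact h1.trans (one_le_pow₀ (by exact_mod_cast hn))

/-- The bound `two_rpow_le_card` does not depend on `k`; dividing by `k ^ 2 ≥ 1` only weakens it. -/
theorem card_lower_bound {r k : ℕ} (hk : 1 ≤ k) {σ : Type} [Fintype σ] {M : NFA (Letter r) σ}
    (hacc : M.accepts = hierarchyLanguage r k)
    (ho : (fun n : ℕ => (ambiguity M n : ℝ)) =o[atTop] fun n : ℕ => (n : ℝ) ^ k) :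
    (2 : ℝ) ^ (1 / 2 ^ 38 * ((r : ℝ) / (k : ℝ) ^ 2) ^ (1 / 3 : ℝ)) ≤ Fintype.card σ := by
  refine le_trans ?_ (two_rpow_le_card hk hacc ho)
  apply Real.rpow_le_rpow_of_exponent_le (by norm_num)
  rw [div_mul_eq_mul_div, one_mul]
  have hk' : (1 : ℝ) ≤ (k : ℝ) ^ 2 := one_le_pow₀ (by exact_mod_cast hk)
  gcongr
  exact div_le_self (by positivity) hk'

theorem exists_small_nfa {r k : ℕ} (hk : 1 ≤ k) :
    ∃ (σ : Type) (_ : Fintype σ) (M : NFA (Letter r) σ), (∃ q₀ : σ, M.start = {q₀}) ∧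
      M.accepts = hierarchyLanguage r k ∧
      ((fun n : ℕ => (ambiguity M n : ℝ)) =O[atTop] fun n : ℕ => (n : ℝ) ^ k) ∧
      Fintype.card σ ≤ k * (r * (r ^ 32 + 5) + 1) := by
  rcases Nat.eq_zero_or_pos r with rfl | hr
  -- The summand `1` in the size bound pays for this single state, as the rest vanishes at `r = 0`.
  · exact ⟨Unit, inferInstance, nilNFA _, ⟨(), rfl⟩, nilNFA_accepts k, nilNFA_isBigO k, by simpa using hk⟩
  · have ht := iterations_pos hr
    exact ⟨_, inferInstance, guessNFA r k (iterations r) ht, ⟨_, rfl⟩, guessNFA_accepts ht,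
      guessNFA_isBigO ht, (card_guessState_le hk).trans (by gcongr; omega)⟩

/-- The automaton has at most `r ^ 35` states, and `35 / 210 = 1 / 6`. The other factor `r ^ (1 /
6)` of `r ^ (1 / 3)` absorbs `2 ^ 38`, as `228 = 6 * 38`. -/
lemma card_rpow_le {r k : ℕ} (hk : 1 ≤ k) (hr : k ≤ r) (hr' : 2 ^ 228 ≤ r) :
    (Fintype.card (GuessState r k (iterations r)) : ℝ) ^ (1 / 210 : ℝ) ≤
      (r : ℝ) ^ (1 / 3 : ℝ) / 2 ^ 38 := by
  have hr6 : 6 ≤ r := le_trans (by norm_num) hr'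
  have hr0 : (0 : ℝ) < r := by exact_mod_cast (by omega : 0 < r)
  have h1 : Fintype.card (GuessState r k (iterations r)) ≤ r ^ 35 := by
    refine (card_guessState_le hk).trans ?_
    have h2 : r ^ 32 + 5 ≤ r ^ 33 := by
      have : 1 ≤ r ^ 32 := Nat.one_le_pow _ _ (by omega)
      rw [pow_succ r 32]
      nlinarith
    calc k * (r * (r ^ 32 + 5)) ≤ r * (r * r ^ 33) := by gcongr
      _ = r ^ 35 := by ring
  have h2 : (Fintype.card (GuessState r k (iterations r)) : ℝ) ≤ (r : ℝ) ^ (35 : ℝ) := by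
    have : (Fintype.card (GuessState r k (iterations r)) : ℝ) ≤ (r : ℝ) ^ 35 := by exact_mod_cast h1
    refine this.trans_eq ?_
    rw [← Real.rpow_natCast]
    norm_num
  have h3 : (2 : ℝ) ^ 38 ≤ (r : ℝ) ^ (1 / 6 : ℝ) := by
    have h4 : ((2 : ℝ) ^ (228 : ℝ)) ≤ r := by
      have : (2 : ℝ) ^ 228 ≤ r := by exact_mod_cast hr'
      refine le_trans (le_of_eq ?_) this
      rw [← Real.rpow_natCast]
      norm_num
    calc (2 : ℝ) ^ 38 = ((2 : ℝ) ^ (228 : ℝ)) ^ (1 / 6 : ℝ) := by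
          rw [← Real.rpow_mul (by norm_num), ← Real.rpow_natCast]
          norm_num
      _ ≤ _ := Real.rpow_le_rpow (by positivity) h4 (by norm_num)
  rw [le_div_iff₀ (by positivity)]
  calc (Fintype.card (GuessState r k (iterations r)) : ℝ) ^ (1 / 210 : ℝ) * 2 ^ 38
      ≤ ((r : ℝ) ^ (35 : ℝ)) ^ (1 / 210 : ℝ) * (r : ℝ) ^ (1 / 6 : ℝ) := by
        gcongr
    _ = (r : ℝ) ^ (1 / 3 : ℝ) := by
        rw [← Real.rpow_mul hr0.le, ← Real.rpow_add hr0]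
        norm_num

theorem exists_hierarchy {k : ℕ} (hk : 1 ≤ k) (s : ℕ) :
    ∃ (α : Type) (_ : Fintype α) (σ : Type) (_ : Fintype σ) (M : NFA α σ),
      (∃ q₀ : σ, M.start = {q₀}) ∧
      ((fun n : ℕ => (ambiguity M n : ℝ)) =O[atTop] fun n : ℕ => (n : ℝ) ^ k) ∧
      s ≤ Fintype.card σ ∧
      ∀ (τ : Type) [Fintype τ] (M' : NFA α τ), M'.accepts = M.accepts →
        ((fun n : ℕ => (ambiguity M' n : ℝ)) =o[atTop] fun n : ℕ => (n : ℝ) ^ k) →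
        (2 : ℝ) ^ ((Fintype.card σ : ℝ) ^ (1 / 210 : ℝ)) ≤ (Fintype.card τ : ℝ) := by
  -- The summand `k` lets a power of `r` absorb the factor `k` in the number of states, `s` makes
  -- the automaton large enough, and `2 ^ 228` is for `card_rpow_le`.
  obtain ⟨r, hr⟩ : ∃ r, r = k + s + 2 ^ 228 := ⟨_, rfl⟩
  have hr0 : 0 < r := by omega
  have ht := iterations_pos hr0
  refine ⟨Letter r, inferInstance, _, inferInstance, guessNFA r k (iterations r) ht, ⟨_, rfl⟩,
    guessNFA_isBigO ht, ?_, ?_⟩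
  · rw [card_guessState]
    calc s ≤ r := by omega
      _ ≤ r ^ 32 := Nat.le_self_pow (by norm_num) r
      _ ≤ 1 * (1 * (r ^ 32 + 1)) := by omega
      _ ≤ k * (iterations r * (r ^ 32 + 1)) := by gcongr; omega
      _ ≤ _ := Nat.le_add_left _ _
  · intro τ _ M' hM' ho
    refine le_trans ?_ (two_rpow_le_card hk (hM'.trans (guessNFA_accepts ht)) ho)
    exact Real.rpow_le_rpow_of_exponent_le (by norm_num)
      (card_rpow_le hk (by omega) (by omega))

end Main

end PolyAmbiguity

theorem theorem1 :
    (∃ c : ℝ, 0 < c ∧ ∀ r k : ℕ, 1 ≤ k →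
      ∀ (σ : Type) [Fintype σ] (M : NFA (PolyAmbiguity.Letter r) σ),
        M.accepts = PolyAmbiguity.hierarchyLanguage r k →
        ((fun n : ℕ => (PolyAmbiguity.ambiguity M n : ℝ)) =o[atTop] fun n : ℕ => (n : ℝ) ^ k) →
        (2 : ℝ) ^ (c * ((r : ℝ) / (k : ℝ) ^ 2) ^ (1 / 3 : ℝ)) ≤ (Fintype.card σ : ℝ)) ∧
    (∃ p : Polynomial ℕ, ∀ r k : ℕ, 1 ≤ k →
      ∃ (σ : Type) (_ : Fintype σ) (M : NFA (PolyAmbiguity.Letter r) σ),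
        (∃ q₀ : σ, M.start = {q₀}) ∧
        M.accepts = PolyAmbiguity.hierarchyLanguage r k ∧
        ((fun n : ℕ => (PolyAmbiguity.ambiguity M n : ℝ)) =O[atTop] fun n : ℕ => (n : ℝ) ^ k) ∧
        Fintype.card σ ≤ k * p.eval r) ∧
    (∃ δ : ℝ, 0 < δ ∧ ∀ k : ℕ, 1 ≤ k → ∀ s : ℕ,
      ∃ (α : Type) (_ : Fintype α) (σ : Type) (_ : Fintype σ) (M : NFA α σ),
        (∃ q₀ : σ, M.start = {q₀}) ∧
        ((fun n : ℕ => (PolyAmbiguity.ambiguity M n : ℝ)) =O[atTop] fun n : ℕ => (n : ℝ) ^ k) ∧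
        s ≤ Fintype.card σ ∧
        ∀ (τ : Type) [Fintype τ] (M' : NFA α τ), M'.accepts = M.accepts →
          ((fun n : ℕ => (PolyAmbiguity.ambiguity M' n : ℝ)) =o[atTop] fun n : ℕ => (n : ℝ) ^ k) →
          (2 : ℝ) ^ ((Fintype.card σ : ℝ) ^ δ) ≤ (Fintype.card τ : ℝ)) := by
  refine ⟨⟨1 / 2 ^ 38, by norm_num, fun r k hk σ _ M hacc ho =>
      PolyAmbiguity.card_lower_bound hk hacc ho⟩,
    ⟨Polynomial.X * (Polynomial.X ^ 32 + 5) + 1, fun r k hk => ?_⟩,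
    ⟨1 / 210, by norm_num, fun k hk s => PolyAmbiguity.exists_hierarchy hk s⟩⟩
  simpa using PolyAmbiguity.exists_small_nfa (r := r) hk
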